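/- **Conventions.** C*-algebras need not be unital. For C*-algebras $\mathcal A,\mathcal B$, an $\mathcal A$-$\mathcal B$ *correspondence* is a right Hilbert $\mathcal B$-module $X$ with a $*$-homomorphism $\phi_X:\mathcal A\to\mathcal L(X)$ into the adjointable operators, nondegenerate in the sense that the linear span of $\phi_X(\mathcal A)X$ is dense in $X$; an *$\mathcal A$-correspondence* is an $\mathcal A$-$\mathcal A$ correspondence. $X\cong Y$ means that there is a surjective bimodule map $X\to Y$ preserving the inner products, and $X\otimes_{\mathcal B}Y$ is the interior tensor product, i.e. the separated completion of the algebraic tensor product for $\langle \xi\otimes\eta,\xi'\otimes\eta'\rangle=\langle\eta,\langle\xi,\xi'\rangle\eta'\rangle$. An $\mathcal A$-correspondence $X$ is *elementary strong shift related* to a $\mathcal B$-correspondence $Y$ if there are an $\mathcal A$-$\mathcal B$ correspondence $R$ and a $\mathcal B$-$\mathcal A$ correspondence $S$ with $X\cong R\otimes_{\mathcal B}S$ and $S\otimes_{\mathcal A}R\cong Y$. For $m\ge1$, $X$ and $Y$ are *strong shift equivalent with lag $m$* if there are C*-algebras $\mathcal C_i$ and $\mathcal C_i$-correspondences $X_i$,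 $0\le i\le m$, with $X_0=X$, $X_m=Y$ and $X_i$ elementary strong shift related to $X_{i+1}$ for $0\le i<m$. Finite square matrices $A,B$ over $\mathbb N=\{0,1,2,\dots\}$ are *strong shift equivalent with lag $m\ge 1$* if there are finite square matrices $A=A_0,A_1,\dots,A_m=B$ over $\mathbb N$ and finite rectangular matrices $R_i,S_i$ over $\mathbb N$ with $A_{i-1}=R_iS_i$ and $S_iR_i=A_i$ for $1\le i\le m$. A matrix is *essential* if it has no zero row and no zero column. For a finite $V\times V$ matrix $A$ over $\mathbb N$ let $E_A$ be the set of edges of the graph with $A_{vw}$ edges $e$ from $s(e)=v$ to $r(e)=w$ for all $v,w \in V$. The *graph correspondence* $X(A)$ is the $\mathbb C^V$-correspondence of all functions $E_A\to\mathbb C$ with $(a\cdot\xi\cdot b)(e)=a(s(e))\,\xi(e)\,b(r(e))$ and $\langle\xi,\eta\rangle(w)=\sum_{r(e)=w}\overline{\xi(e)}\,\eta(e)$. **Theorem.** Let $A$ and $B$ be finite essential square matrices with entries in $\mathbb N$. For every integer $m\ge1$, the graph correspondences $X(A)$ and $X(B)$ are strong shift equivalent with lag $m$ if and only if the matrices $A$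 and $B$ are strong shift equivalent with lag $m$. In particular, $X(A)$ and $X(B)$ are strong shift equivalent (with some lag) if and only if $A$ and $B$ are. -/

import Mathlib

open scoped TensorProduct

universe u

noncomputable section

/-- Let `A`, `B` be C*-algebras (unital or not) and `E` a complex vector space. A
*semi-correspondence* on `E` is the structure of an `A`-`B` correspondence, except that the
`B`-valued inner product is only positive semidefinite and no completeness is required:
a right action `rsmul b x = x · b` of `B`, a `B`-valued semi-inner product, conjugate linear in the
first and (complex and `B`-) linear in the second variable, and a left action `lsmul a x = a · x`
of `A` which is a `*`-representation, `a` being adjointable with adjoint `a*`.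
The positive elements of `B` are those of the form `b* b`. -/
structure SemiCorrespondence (A B E : Type u) [NonUnitalCStarAlgebra A] [NonUnitalCStarAlgebra B]
    [AddCommGroup E] [Module ℂ E] where
  inner : E →ₗ⋆[ℂ] E →ₗ[ℂ] B
  lsmul : A →ₗ[ℂ] E →ₗ[ℂ] E
  rsmul : B →ₗ[ℂ] E →ₗ[ℂ] E
  star_inner : ∀ x y, star (inner x y) = inner y x
  inner_self_pos : ∀ x, ∃ b : B, inner x x = star b * b
  inner_rsmul : ∀ x y b, inner x (rsmul b y) = inner x y * b
  rsmul_mul : ∀ b c x, rsmul (b * c) x = rsmul c (rsmul b x)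
  lsmul_mul : ∀ a a' x, lsmul (a * a') x = lsmul a (lsmul a' x)
  inner_lsmul : ∀ a x y, inner (lsmul a x) y = inner x (lsmul (star a) y)

namespace SemiCorrespondence

variable {A B E : Type u} [NonUnitalCStarAlgebra A] [NonUnitalCStarAlgebra B]
    [AddCommGroup E] [Module ℂ E] (P : SemiCorrespondence A B E)

lemma rsmul_inner (x y : E) (b : B) : P.inner (P.rsmul b x) y = star b * P.inner x y := by
  rw [← P.star_inner, P.inner_rsmul, star_mul, P.star_inner]

lemma inner_smul_left (c : ℂ) (x y : E) :
    P.inner (c • x) y = (starRingEnd ℂ c) • P.inner x y := by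
  rw [P.inner.map_smulₛₗ, LinearMap.smul_apply]

lemma inner_smul_right (c : ℂ) (x y : E) : P.inner x (c • y) = c • P.inner x y :=
  (P.inner x).map_smul c y

lemma norm_inner_sq_le (x y : E) :
    ‖P.inner x y‖ ^ 2 ≤ ‖P.inner x x‖ * ‖P.inner y y‖ := by
  let _ := CStarAlgebra.spectralOrder B
  have := CStarAlgebra.spectralOrderedRing B
  have pos : ∀ z, 0 ≤ P.inner z z := fun z => by
    obtain ⟨b, hb⟩ := P.inner_self_pos z
    rw [hb]; exact star_mul_self_nonneg b
  set r := ‖P.inner x x‖ with hr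
  -- for every real `t ≥ r`, `t • ⟨y,x⟩⟨x,y⟩ ≤ t² • ⟨y,y⟩`
  have key : ∀ t : ℝ, r ≤ t → 0 < t → ‖P.inner x y‖ ^ 2 ≤ t * ‖P.inner y y‖ := by
    intro t hrt ht
    have h0 := pos (P.rsmul (P.inner x y) x - (t : ℂ) • y)
    have e : P.inner (P.rsmul (P.inner x y) x - (t : ℂ) • y)
        (P.rsmul (P.inner x y) x - (t : ℂ) • y)
        = star (P.inner x y) * P.inner x x * P.inner x y
          - t • (star (P.inner x y) * P.inner x y) - t • (star (P.inner x y) * P.inner x y)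
          + t • t • P.inner y y := by
      simp only [map_sub, LinearMap.sub_apply, P.inner_rsmul, P.rsmul_inner, P.inner_smul_left,
        P.inner_smul_right, Complex.conj_ofReal, P.star_inner, smul_mul_assoc, mul_smul_comm]
      simp only [Complex.coe_smul]
      abel
    have h1 : star (P.inner x y) * P.inner x x * P.inner x y
        ≤ t • (star (P.inner x y) * P.inner x y) := by
      refine (CStarAlgebra.star_left_conjugate_le_norm_smul).trans ?_
      exact smul_le_smul_of_nonneg_right hrt (star_mul_self_nonneg _)
    rw [e] at h0
    have h2 : t • (star (P.inner x y) * P.inner x y) ≤ t • t • P.inner y y := by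
      have h3 := add_le_add h0 h1
      rw [← sub_nonneg] at h3 ⊢
      convert h3 using 1
      abel
    have h4 : star (P.inner x y) * P.inner x y ≤ t • P.inner y y :=
      (smul_le_smul_iff_of_pos_left ht).1 h2
    have h5 := CStarAlgebra.norm_le_norm_of_nonneg_of_le (star_mul_self_nonneg _) h4
    rw [CStarRing.norm_star_mul_self, norm_smul, Real.norm_of_nonneg ht.le] at h5
    rw [pow_two]; exact h5
  have hr0 : 0 ≤ r := norm_nonneg _
  refine le_of_forall_pos_le_add fun ε hε => ?_
  set s := ‖P.inner y y‖
  have hs : 0 ≤ s := norm_nonneg _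
  have := key (r + ε / (s + 1)) (by linarith [show 0 < ε / (s+1) by positivity]) (by positivity)
  have h6 : ε / (s + 1) * s ≤ ε := by
    rw [div_mul_eq_mul_div, div_le_iff₀ (by positivity)]; nlinarith
  linarith [add_mul r (ε / (s+1)) s]

/-- The seminorm `‖x‖ = ‖⟨x, x⟩‖^{1/2}` of a semi-correspondence. -/
def seminorm (x : E) : ℝ := √‖P.inner x x‖

lemma seminorm_nonneg (x : E) : 0 ≤ P.seminorm x := Real.sqrt_nonneg _

lemma seminorm_sq (x : E) : P.seminorm x ^ 2 = ‖P.inner x x‖ :=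
  Real.sq_sqrt (norm_nonneg _)

lemma norm_inner_le (x y : E) : ‖P.inner x y‖ ≤ P.seminorm x * P.seminorm y := by
  rw [seminorm, seminorm, ← Real.sqrt_mul (norm_nonneg _)]
  exact Real.le_sqrt_of_sq_le (P.norm_inner_sq_le x y)

lemma seminorm_smul (c : ℂ) (x : E) : P.seminorm (c • x) = ‖c‖ * P.seminorm x := by
  rw [seminorm, seminorm, P.inner_smul_left, P.inner_smul_right, norm_smul, norm_smul,
    RCLike.norm_conj, ← mul_assoc, Real.sqrt_mul (by positivity),
    Real.sqrt_mul_self (norm_nonneg _)]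

lemma seminorm_add_le (x y : E) : P.seminorm (x + y) ≤ P.seminorm x + P.seminorm y := by
  have hn : ∀ z, 0 ≤ P.seminorm z := fun z => Real.sqrt_nonneg _
  refine abs_le_of_sq_le_sq' ?_ (add_nonneg (hn x) (hn y)) |>.2
  rw [P.seminorm_sq]
  have h : P.inner (x + y) (x + y)
      = P.inner x x + P.inner y x + P.inner x y + P.inner y y := by
    simp only [map_add, LinearMap.add_apply]
    abel
  rw [h]
  have := norm_add₄_le (a := P.inner x x) (b := P.inner y x) (c := P.inner x y)
    (d := P.inner y y)
  nlinarith [P.norm_inner_le x y, P.norm_inner_le y x, P.seminorm_sq x, P.seminorm_sq y]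

lemma seminorm_rsmul_le (b : B) (x : E) : P.seminorm (P.rsmul b x) ≤ ‖b‖ * P.seminorm x := by
  refine abs_le_of_sq_le_sq' ?_ (mul_nonneg (norm_nonneg _) (P.seminorm_nonneg _)) |>.2
  rw [mul_pow, P.seminorm_sq, P.seminorm_sq, P.inner_rsmul, P.rsmul_inner]
  calc ‖star b * P.inner x x * b‖ ≤ ‖star b‖ * ‖P.inner x x‖ * ‖b‖ :=
        (norm_mul_le _ _).trans (mul_le_mul_of_nonneg_right (norm_mul_le _ _) (norm_nonneg _))
    _ = ‖b‖ ^ 2 * ‖P.inner x x‖ := by rw [norm_star]; ring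

lemma seminorm_lsmul_le (a : A) (x : E) : P.seminorm (P.lsmul a x) ≤ ‖a‖ * P.seminorm x := by
  let _ := CStarAlgebra.spectralOrder B
  have := CStarAlgebra.spectralOrderedRing B
  let _ := CStarAlgebra.spectralOrder (Unitization ℂ A)
  have := CStarAlgebra.spectralOrderedRing (Unitization ℂ A)
  have pos : ∀ z, 0 ≤ P.inner z z := fun z => by
    obtain ⟨b, hb⟩ := P.inner_self_pos z
    rw [hb]; exact star_mul_self_nonneg b
  -- the action of the unitization
  let T : Unitization ℂ A → E → E := fun d z => d.fst • z + P.lsmul d.snd z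
  have hT : ∀ d z, P.inner (T d z) (T d z) = P.inner z (T (star d * d) z) := by
    intro d z
    simp only [T, map_add, LinearMap.add_apply, P.inner_smul_left, P.inner_smul_right,
      P.inner_lsmul, Unitization.fst_mul, Unitization.snd_mul, Unitization.fst_star,
      Unitization.snd_star, map_smul, LinearMap.smul_apply, P.lsmul_mul, smul_add,
      mul_smul, RCLike.star_def]
    rw [smul_comm d.fst]
    abel
  obtain ⟨d, hd⟩ := CStarAlgebra.nonneg_iff_eq_star_mul_self.1
    (sub_nonneg.2 (CStarAlgebra.star_mul_le_algebraMap_norm_sq (a := (a : Unitization ℂ A))))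
  have h1 := hT d x
  rw [← hd] at h1
  have h2 : P.inner x (T (algebraMap ℝ (Unitization ℂ A) (‖(a : Unitization ℂ A)‖ ^ 2)
      - star (a : Unitization ℂ A) * (a : Unitization ℂ A)) x)
      = (‖a‖ ^ 2) • P.inner x x - P.inner (P.lsmul a x) (P.lsmul a x) := by
    simp only [T, P.inner_lsmul]
    simp [Unitization.norm_inr, Unitization.algebraMap_eq_inl_comp, P.lsmul_mul, sub_eq_add_neg]
    rw [← Complex.ofReal_pow, Complex.coe_smul]
  have h3 : P.inner (P.lsmul a x) (P.lsmul a x) ≤ (‖a‖ ^ 2) • P.inner x x := by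
    rw [← sub_nonneg, ← h2, ← h1]; exact pos _
  have h4 := CStarAlgebra.norm_le_norm_of_nonneg_of_le (pos _) h3
  refine abs_le_of_sq_le_sq' ?_ (mul_nonneg (norm_nonneg _) (P.seminorm_nonneg _)) |>.2
  rw [mul_pow, P.seminorm_sq, P.seminorm_sq]
  rwa [norm_smul, Real.norm_of_nonneg (by positivity)] at h4

/-- The vector space underlying a semi-correspondence, with its seminorm. -/
@[nolint unusedArguments]
def Space (_P : SemiCorrespondence A B E) : Type u := E

instance : AddCommGroup P.Space := inferInstanceAs (AddCommGroup E)
instance : Module ℂ P.Space := inferInstanceAs (Module ℂ E)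
instance : Norm P.Space := ⟨P.seminorm⟩

lemma seminormCore : SeminormedSpace.Core ℂ P.Space where
  norm_nonneg _ := Real.sqrt_nonneg _
  norm_smul := P.seminorm_smul
  norm_triangle := P.seminorm_add_le

instance : SeminormedAddCommGroup P.Space := .ofCore P.seminormCore
instance : NormedSpace ℂ P.Space where
  norm_smul_le c x := (P.seminorm_smul c x).le


/-- The separated completion of the space underlying a semi-correspondence. -/
abbrev Compl : Type u := UniformSpace.Completion P.Space

/-- The canonical map to the separated completion. -/
def toCompl : E →ₗ[ℂ] P.Compl :=
  (UniformSpace.Completion.toComplL (𝕜 := ℂ) (E := P.Space)).toLinearMap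

lemma norm_toCompl (x : E) : ‖P.toCompl x‖ = P.seminorm x :=
  UniformSpace.Completion.norm_coe (E := P.Space) x

lemma denseRange_toCompl : DenseRange P.toCompl :=
  UniformSpace.Completion.denseRange_coe (α := P.Space)

@[elab_as_elim]
lemma compl_induction {p : P.Compl → Prop} (x : P.Compl) (hp : IsClosed {x | p x})
    (h : ∀ x, p (P.toCompl x)) : p x :=
  P.denseRange_toCompl.induction_on x hp h

@[elab_as_elim]
lemma compl_induction₂ {p : P.Compl → P.Compl → Prop} (x y : P.Compl)
    (hp : IsClosed {q : P.Compl × P.Compl | p q.1 q.2})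
    (h : ∀ x y, p (P.toCompl x) (P.toCompl y)) : p x y :=
  P.denseRange_toCompl.induction_on₂ hp h x y

@[elab_as_elim]
lemma compl_induction₃ {p : P.Compl → P.Compl → P.Compl → Prop} (x y z : P.Compl)
    (hp : IsClosed {q : P.Compl × P.Compl × P.Compl | p q.1 q.2.1 q.2.2})
    (h : ∀ x y z, p (P.toCompl x) (P.toCompl y) (P.toCompl z)) : p x y z :=
  P.denseRange_toCompl.induction_on₃ hp h x y z

/-- A bounded operator, extended to the completion. -/
def extendOp (f : E →ₗ[ℂ] E) (C : ℝ) (hf : ∀ x, P.seminorm (f x) ≤ C * P.seminorm x) :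
    P.Compl →L[ℂ] P.Compl :=
  ((UniformSpace.Completion.toComplL (𝕜 := ℂ) (E := P.Space)).comp
    (LinearMap.mkContinuous (E := P.Space) (F := P.Space) (σ := RingHom.id ℂ) f C hf)).extend
    (UniformSpace.Completion.toComplL (𝕜 := ℂ) (E := P.Space))

lemma extendOp_toCompl (f : E →ₗ[ℂ] E) (C : ℝ)
    (hf : ∀ x, P.seminorm (f x) ≤ C * P.seminorm x) (x : E) :
    P.extendOp f C hf (P.toCompl x) = P.toCompl (f x) :=
  ContinuousLinearMap.extend_eq
    (e := UniformSpace.Completion.toComplL (𝕜 := ℂ) (E := P.Space)) _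
    (UniformSpace.Completion.denseRange_coe)
    (UniformSpace.Completion.isUniformInducing_coe _) x

/-- The left action, extended to the completion. -/
def complLsmul : A →ₗ[ℂ] P.Compl →ₗ[ℂ] P.Compl where
  toFun a := (P.extendOp (P.lsmul a) ‖a‖ (P.seminorm_lsmul_le a)).toLinearMap
  map_add' a a' := by
    ext x
    refine P.compl_induction x (isClosed_eq (ContinuousLinearMap.continuous _)
      ((ContinuousLinearMap.continuous _).add (ContinuousLinearMap.continuous _))) fun x => ?_
    simp [extendOp_toCompl]
  map_smul' c a := by
    ext x
    refine P.compl_induction x (isClosed_eq (ContinuousLinearMap.continuous _)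
      ((ContinuousLinearMap.continuous _).const_smul c)) fun x => ?_
    simp [extendOp_toCompl]

/-- The right action, extended to the completion. -/
def complRsmul : B →ₗ[ℂ] P.Compl →ₗ[ℂ] P.Compl where
  toFun b := (P.extendOp (P.rsmul b) ‖b‖ (P.seminorm_rsmul_le b)).toLinearMap
  map_add' b b' := by
    ext x
    refine P.compl_induction x (isClosed_eq (ContinuousLinearMap.continuous _)
      ((ContinuousLinearMap.continuous _).add (ContinuousLinearMap.continuous _))) fun x => ?_
    simp [extendOp_toCompl]
  map_smul' c b := by
    ext x
    refine P.compl_induction x (isClosed_eq (ContinuousLinearMap.continuous _)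
      ((ContinuousLinearMap.continuous _).const_smul c)) fun x => ?_
    simp [extendOp_toCompl]

lemma complLsmul_toCompl (a : A) (x : E) :
    P.complLsmul a (P.toCompl x) = P.toCompl (P.lsmul a x) :=
  P.extendOp_toCompl _ _ _ x

lemma complRsmul_toCompl (b : B) (x : E) :
    P.complRsmul b (P.toCompl x) = P.toCompl (P.rsmul b x) :=
  P.extendOp_toCompl _ _ _ x

@[fun_prop]
lemma continuous_complLsmul (a : A) : Continuous (P.complLsmul a) :=
  ContinuousLinearMap.continuous (P.extendOp (P.lsmul a) ‖a‖ (P.seminorm_lsmul_le a))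

@[fun_prop]
lemma continuous_complRsmul (b : B) : Continuous (P.complRsmul b) :=
  ContinuousLinearMap.continuous (P.extendOp (P.rsmul b) ‖b‖ (P.seminorm_rsmul_le b))

lemma continuous_inner_space : Continuous fun p : P.Space × P.Space => P.inner p.1 p.2 := by
  let f : P.Space →ₗ⋆[ℂ] P.Space →ₗ[ℂ] B := P.inner
  let g : P.Space →L⋆[ℂ] P.Space →L[ℂ] B :=
    LinearMap.mkContinuous₂ f 1 (fun x y => by rw [one_mul]; exact P.norm_inner_le x y)
  have h : Continuous fun p : P.Space × P.Space => g p.1 p.2 :=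
    (g.continuous.comp continuous_fst).clm_apply continuous_snd
  exact h

/-- The inner product, extended to the completion. -/
def complInnerFun (x y : P.Compl) : B :=
  ((UniformSpace.Completion.isDenseInducing_toCompl P.Space).prodMap
    (UniformSpace.Completion.isDenseInducing_toCompl P.Space)).extend
    (fun p : P.Space × P.Space => P.inner p.1 p.2) (x, y)

lemma complInnerFun_toCompl (x y : E) :
    P.complInnerFun (P.toCompl x) (P.toCompl y) = P.inner x y :=
  ((UniformSpace.Completion.isDenseInducing_toCompl P.Space).prodMap
    (UniformSpace.Completion.isDenseInducing_toCompl P.Space)).extend_eq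
    P.continuous_inner_space (x, y)

lemma continuous_complInnerFun :
    Continuous fun p : P.Compl × P.Compl => P.complInnerFun p.1 p.2 := by
  let f : P.Space →+ P.Space →+ B :=
    { toFun := fun x => (P.inner x).toAddMonoidHom
      map_zero' := by ext x; exact LinearMap.map_zero₂ P.inner x
      map_add' := fun x y => by ext z; exact LinearMap.map_add₂ P.inner x y z }
  have h : Continuous fun p : P.Space × P.Space => f p.1 p.2 := P.continuous_inner_space
  exact (UniformSpace.Completion.isDenseInducing_toCompl P.Space).extend_Z_bilin
    (UniformSpace.Completion.isDenseInducing_toCompl P.Space) h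

@[fun_prop]
lemma continuous_complInnerFun_comp {α : Type*} [TopologicalSpace α] {f g : α → P.Compl}
    (hf : Continuous f) (hg : Continuous g) :
    Continuous fun x => P.complInnerFun (f x) (g x) :=
  P.continuous_complInnerFun.comp (hf.prodMk hg)

lemma complInnerFun_add_left (x y z : P.Compl) :
    P.complInnerFun (x + y) z = P.complInnerFun x z + P.complInnerFun y z := by
  refine P.compl_induction₃ x y z (isClosed_eq (by fun_prop) (by fun_prop)) fun a b c => ?_
  rw [← map_add P.toCompl]
  simp only [complInnerFun_toCompl]
  rw [map_add, LinearMap.add_apply]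

lemma complInnerFun_add_right (x y z : P.Compl) :
    P.complInnerFun x (y + z) = P.complInnerFun x y + P.complInnerFun x z := by
  refine P.compl_induction₃ x y z (isClosed_eq (by fun_prop) (by fun_prop)) fun a b c => ?_
  rw [← map_add P.toCompl]
  simp only [complInnerFun_toCompl]
  rw [map_add]

lemma complInnerFun_smul_left (c : ℂ) (x y : P.Compl) :
    P.complInnerFun (c • x) y = (starRingEnd ℂ c) • P.complInnerFun x y := by
  refine P.compl_induction₂ x y (isClosed_eq
    (P.continuous_complInnerFun_comp (continuous_fst.const_smul c) continuous_snd)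
    (P.continuous_complInnerFun.const_smul _)) fun a b => ?_
  rw [← map_smul P.toCompl, complInnerFun_toCompl, complInnerFun_toCompl, P.inner_smul_left]

lemma complInnerFun_smul_right (c : ℂ) (x y : P.Compl) :
    P.complInnerFun x (c • y) = c • P.complInnerFun x y := by
  refine P.compl_induction₂ x y (isClosed_eq
    (P.continuous_complInnerFun_comp continuous_fst (continuous_snd.const_smul c))
    (P.continuous_complInnerFun.const_smul _)) fun a b => ?_
  rw [← map_smul P.toCompl, complInnerFun_toCompl, complInnerFun_toCompl, P.inner_smul_right]

/-- The inner product on the completion, as a sesquilinear map. -/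
def complInner : P.Compl →ₗ⋆[ℂ] P.Compl →ₗ[ℂ] B :=
  LinearMap.mk₂'ₛₗ (starRingEnd ℂ) (RingHom.id ℂ) P.complInnerFun P.complInnerFun_add_left
    P.complInnerFun_smul_left P.complInnerFun_add_right P.complInnerFun_smul_right

lemma complInner_toCompl (x y : E) :
    P.complInner (P.toCompl x) (P.toCompl y) = P.inner x y :=
  P.complInnerFun_toCompl x y

@[fun_prop]
lemma continuous_complInner {α : Type*} [TopologicalSpace α] {f g : α → P.Compl}
    (hf : Continuous f) (hg : Continuous g) :
    Continuous fun x => P.complInner (f x) (g x) :=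
  P.continuous_complInnerFun_comp hf hg

/-- The semi-correspondence structure, extended to the separated completion. -/
def complSemi : SemiCorrespondence A B P.Compl where
  inner := P.complInner
  lsmul := P.complLsmul
  rsmul := P.complRsmul
  star_inner x y := P.compl_induction₂ x y (isClosed_eq (by fun_prop) (by fun_prop))
    fun x y => by simp only [complInner_toCompl, P.star_inner]
  inner_self_pos x := by
    let _ := CStarAlgebra.spectralOrder B
    have := CStarAlgebra.spectralOrderedRing B
    refine CStarAlgebra.nonneg_iff_eq_star_mul_self.1 ?_
    refine P.compl_induction x (isClosed_le (by fun_prop) (by fun_prop)) fun a => ?_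
    rw [complInner_toCompl]
    exact CStarAlgebra.nonneg_iff_eq_star_mul_self.2 (P.inner_self_pos a)
  inner_rsmul x y b := P.compl_induction₂ x y (isClosed_eq (by fun_prop) (by fun_prop))
    fun x y => by simp only [complRsmul_toCompl, complInner_toCompl, P.inner_rsmul]
  rsmul_mul b c x := P.compl_induction x (isClosed_eq (by fun_prop) (by fun_prop))
    fun x => by simp only [complRsmul_toCompl, P.rsmul_mul]
  lsmul_mul a a' x := P.compl_induction x (isClosed_eq (by fun_prop) (by fun_prop))
    fun x => by simp only [complLsmul_toCompl, P.lsmul_mul]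
  inner_lsmul a x y := P.compl_induction₂ x y (isClosed_eq (by fun_prop) (by fun_prop))
    fun x y => by simp only [complLsmul_toCompl, complInner_toCompl, P.inner_lsmul]

end SemiCorrespondence

/-- Let `A` and `B` be C*-algebras. An `A`-`B` *correspondence* is a right Hilbert `B`-module `X`
(a complex vector space with a right action of `B` and a `B`-valued inner product, complete for the
norm `‖x‖ = ‖⟨x, x⟩‖^{1/2}`) with a `*`-representation of `A` by adjointable operators on `X`, which
is nondegenerate: the linear span of the elements `a · x` is dense in `X`.
The inner product is definite since `carrier` is a normed (not only a seminormed) space. -/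
structure Correspondence (A B : Type u) [NonUnitalCStarAlgebra A] [NonUnitalCStarAlgebra B] where
  carrier : Type u
  [normedAddCommGroup : NormedAddCommGroup carrier]
  [normedSpace : NormedSpace ℂ carrier]
  [completeSpace : CompleteSpace carrier]
  toSemi : SemiCorrespondence A B carrier
  norm_sq : ∀ x, ‖x‖ ^ 2 = ‖toSemi.inner x x‖
  nondegenerate : Dense (Submodule.span ℂ {z | ∃ a x, z = toSemi.lsmul a x} : Set carrier)

attribute [instance] Correspondence.normedAddCommGroup Correspondence.normedSpace
  Correspondence.completeSpace

namespace SemiCorrespondence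

variable {A B E : Type u} [NonUnitalCStarAlgebra A] [NonUnitalCStarAlgebra B]
    [AddCommGroup E] [Module ℂ E] (P : SemiCorrespondence A B E)

/-- The separated completion of a nondegenerate semi-correspondence. -/
def completion
    (h : ∀ x : E, ∀ ε > 0, ∃ z ∈ Submodule.span ℂ {z | ∃ a x, z = P.lsmul a x},
      P.seminorm (x - z) < ε) : Correspondence A B where
  carrier := P.Compl
  toSemi := P.complSemi
  norm_sq x := P.compl_induction x
    (isClosed_eq (by fun_prop) (P.continuous_complInner continuous_id continuous_id).norm)
    fun x => by
      rw [norm_toCompl, seminorm_sq]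
      exact congrArg _ (P.complInner_toCompl x x).symm
  nondegenerate := by
    intro x
    refine P.compl_induction x isClosed_closure fun x => ?_
    rw [Metric.mem_closure_iff]
    intro ε hε
    obtain ⟨z, hz, hxz⟩ := h x ε hε
    refine ⟨P.toCompl z, ?_, by rwa [dist_eq_norm, ← map_sub, norm_toCompl]⟩
    have := Submodule.mem_map_of_mem (f := P.toCompl) hz
    rw [Submodule.map_span] at this
    refine Submodule.span_mono ?_ this
    rintro _ ⟨_, ⟨a, y, rfl⟩, rfl⟩
    exact ⟨a, P.toCompl y, (P.complLsmul_toCompl a y).symm⟩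

end SemiCorrespondence

lemma exists_posPart_negPart {D : Type*} [NonUnitalCStarAlgebra D] [PartialOrder D]
    [StarOrderedRing D] (M : D) (hM : star M = M) :
    ∃ p q : D, (∃ r, p = star r * r) ∧ (∃ s, q = star s * s) ∧ q * p = 0 ∧ M = p - q :=
  ⟨M⁺, M⁻, CStarAlgebra.nonneg_iff_eq_star_mul_self.1 (CFC.posPart_nonneg M),
    CStarAlgebra.nonneg_iff_eq_star_mul_self.1 (CFC.negPart_nonneg M),
    CFC.negPart_mul_posPart M, (CFC.posPart_sub_negPart M hM).symm⟩

/-- A self-adjoint matrix over a C*-algebra with positive quadratic form is of the form `T* T`. -/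
lemma CStarMatrix.exists_eq_star_mul_self {B n : Type*} [NonUnitalCStarAlgebra B]
    [PartialOrder B] [StarOrderedRing B] [Fintype n]
    (M : CStarMatrix n n B) (hM : star M = M)
    (h : ∀ b : n → B, 0 ≤ ∑ i, ∑ j, star (b i) * M i j * b j) :
    ∃ T : CStarMatrix n n B, M = star T * T := by
  obtain ⟨p, q, ⟨r, hr⟩, ⟨s, hs⟩, hqp, rfl⟩ := exists_posPart_negPart M hM
  have hq : star q = q := by rw [hs, star_mul, star_star]
  have e1 : star q * (p - q) * q = - (star (s * q) * (s * q)) := by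
    rw [hq, mul_sub, hqp, zero_sub, neg_mul, star_mul, hq]
    conv_lhs => enter [1, 1, 2]; rw [hs]
    simp only [mul_assoc]
  have e2 : ∀ k, ∑ l, star ((s * q) l k) * (s * q) l k = 0 := by
    intro k
    refine le_antisymm ?_ (Finset.sum_nonneg fun l _ => star_mul_self_nonneg _)
    have h1 := h (fun i => q i k)
    have h2 : (star q * (p - q) * q) k k
        = ∑ i, ∑ j, star (q i k) * (p - q) i j * q j k := by
      rw [CStarMatrix.mul_apply, Finset.sum_comm]
      refine Finset.sum_congr rfl fun j _ => ?_
      rw [CStarMatrix.mul_apply, Finset.sum_mul]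
      rfl
    rw [← h2, e1, CStarMatrix.neg_apply, CStarMatrix.mul_apply] at h1
    exact neg_nonneg.1 h1
  have e3 : s * q = 0 := by
    ext l k
    have := (Finset.sum_eq_zero_iff_of_nonneg fun l _ => star_mul_self_nonneg _).1 (e2 k) l
      (Finset.mem_univ l)
    exact CStarRing.star_mul_self_eq_zero_iff _ |>.1 this
  have e4 : q = 0 := by
    have : star q * q = 0 := by
      rw [hq]; conv_lhs => enter [1]; rw [hs]
      rw [mul_assoc, e3, mul_zero]
    exact CStarRing.star_mul_self_eq_zero_iff _ |>.1 this
  exact ⟨r, by rw [e4, sub_zero, hr]⟩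

namespace SemiCorrespondence

variable {A B C E F : Type u} [NonUnitalCStarAlgebra A] [NonUnitalCStarAlgebra B]
    [NonUnitalCStarAlgebra C] [AddCommGroup E] [Module ℂ E] [AddCommGroup F] [Module ℂ F]
    (P : SemiCorrespondence A B E) (Q : SemiCorrespondence B C F)

/-- The linear functional `x' ⊗ y' ↦ ⟨y, ⟨x, x'⟩ y'⟩`. -/
def tensorInnerAux (x : E) (y : F) : E ⊗[ℂ] F →ₗ[ℂ] C :=
  TensorProduct.lift (LinearMap.mk₂ ℂ (fun x' y' => Q.inner y (Q.lsmul (P.inner x x') y'))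
    (fun _ _ _ => by simp only [map_add, LinearMap.add_apply])
    (fun _ _ _ => by simp only [map_smul, LinearMap.smul_apply])
    (fun _ _ _ => by simp only [map_add])
    (fun _ _ _ => by simp only [map_smul]))

/-- The semi-inner product `⟨x ⊗ y, x' ⊗ y'⟩ = ⟨y, ⟨x, x'⟩ y'⟩`. -/
def tensorInner : E ⊗[ℂ] F →ₗ⋆[ℂ] E ⊗[ℂ] F →ₗ[ℂ] C :=
  TensorProduct.lift (LinearMap.mk₂'ₛₗ (starRingEnd ℂ) (starRingEnd ℂ) (P.tensorInnerAux Q)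
    (fun _ _ _ => TensorProduct.ext' fun _ _ => by simp [tensorInnerAux])
    (fun _ _ _ => TensorProduct.ext' fun _ _ => by simp [tensorInnerAux])
    (fun _ _ _ => TensorProduct.ext' fun _ _ => by simp [tensorInnerAux])
    (fun _ _ _ => TensorProduct.ext' fun _ _ => by simp [tensorInnerAux]))

lemma tensorInner_tmul (x x' : E) (y y' : F) :
    P.tensorInner Q (x ⊗ₜ y) (x' ⊗ₜ y') = Q.inner y (Q.lsmul (P.inner x x') y') := rfl

lemma gram_factor {n : Type*} [Fintype n] (x : n → E) :
    ∃ T : n → n → B, ∀ i j, P.inner (x i) (x j) = ∑ k, star (T k i) * T k j := by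
  let _ := CStarAlgebra.spectralOrder B
  have := CStarAlgebra.spectralOrderedRing B
  obtain ⟨T, hT⟩ := CStarMatrix.exists_eq_star_mul_self
    (CStarMatrix.ofMatrix (fun i j => P.inner (x i) (x j)))
    (by ext i j; exact P.star_inner _ _)
    (fun b => by
      have : ∑ i, ∑ j, star (b i) * P.inner (x i) (x j) * b j
          = P.inner (∑ i, P.rsmul (b i) (x i)) (∑ i, P.rsmul (b i) (x i)) := by
        simp only [map_sum, LinearMap.sum_apply, P.inner_rsmul, P.rsmul_inner]
        exact Finset.sum_comm
      exact this ▸ CStarAlgebra.nonneg_iff_eq_star_mul_self.2 (P.inner_self_pos _))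
  refine ⟨T, fun i j => ?_⟩
  have := congrFun (congrFun hT i) j
  exact this

lemma tensorInner_self_pos (z : E ⊗[ℂ] F) :
    ∃ c : C, P.tensorInner Q z z = star c * c := by
  let _ := CStarAlgebra.spectralOrder C
  have := CStarAlgebra.spectralOrderedRing C
  refine CStarAlgebra.nonneg_iff_eq_star_mul_self.1 ?_
  obtain ⟨n, x, y, rfl⟩ : ∃ (n : ℕ) (x : Fin n → E) (y : Fin n → F), z = ∑ i, x i ⊗ₜ y i := by
    obtain ⟨S, rfl⟩ := TensorProduct.exists_finset z
    refine ⟨S.card, fun i => (S.equivFin.symm i).1.1, fun i => (S.equivFin.symm i).1.2, ?_⟩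
    rw [Equiv.sum_comp S.equivFin.symm (fun p : S => p.1.1 ⊗ₜ[ℂ] p.1.2),
      Finset.sum_coe_sort S (fun p => p.1 ⊗ₜ[ℂ] p.2)]
  obtain ⟨T, hT⟩ := P.gram_factor x
  have : P.tensorInner Q (∑ i, x i ⊗ₜ y i) (∑ i, x i ⊗ₜ y i)
      = ∑ k, Q.inner (∑ i, Q.lsmul (T k i) (y i)) (∑ i, Q.lsmul (T k i) (y i)) := by
    simp only [map_sum, LinearMap.sum_apply, tensorInner_tmul, hT, Q.inner_lsmul, Q.lsmul_mul]
    rw [Finset.sum_comm_cycle]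
  rw [this]
  exact Finset.sum_nonneg fun k _ =>
    CStarAlgebra.nonneg_iff_eq_star_mul_self.2 (Q.inner_self_pos _)

/-- The algebraic tensor product over `ℂ`, with
`⟨x ⊗ y, x' ⊗ y'⟩ = ⟨y, ⟨x, x'⟩ y'⟩`, `a · (x ⊗ y) = (a · x) ⊗ y`, `(x ⊗ y) · c = x ⊗ (y · c)`.
The differences `(x · b) ⊗ y - x ⊗ (b · y)` are null vectors of this semi-inner product. -/
def tensor : SemiCorrespondence A C (E ⊗[ℂ] F) where
  inner := P.tensorInner Q
  lsmul := LinearMap.rTensorHom F ∘ₗ P.lsmul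
  rsmul := LinearMap.lTensorHom E ∘ₗ Q.rsmul
  star_inner z w := by
    induction z using TensorProduct.induction_on with
    | zero => simp
    | add z z' hz hz' => simp only [map_add, LinearMap.add_apply, star_add, hz, hz']
    | tmul x y =>
      induction w using TensorProduct.induction_on with
      | zero => simp
      | add w w' hw hw' => simp only [map_add, LinearMap.add_apply, star_add, hw, hw']
      | tmul x' y' =>
        rw [tensorInner_tmul, tensorInner_tmul, Q.star_inner, Q.inner_lsmul, P.star_inner]
  inner_self_pos := P.tensorInner_self_pos Q
  inner_rsmul z w c := by
    induction z using TensorProduct.induction_on with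
    | zero => simp
    | add z z' hz hz' => simp only [map_add, LinearMap.add_apply, add_mul, hz, hz']
    | tmul x y =>
      induction w using TensorProduct.induction_on with
      | zero => simp
      | add w w' hw hw' => simp only [map_add, add_mul, hw, hw']
      | tmul x' y' =>
        have h : ∀ v, Q.inner y (Q.lsmul (P.inner x x') v)
            = Q.inner (Q.lsmul (star (P.inner x x')) y) v := fun v => by
          rw [Q.inner_lsmul, star_star]
        exact (h _).trans ((Q.inner_rsmul _ _ _).trans (congrArg (· * c) (h _).symm))
  rsmul_mul b c z := by
    induction z using TensorProduct.induction_on with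
    | zero => simp
    | add z z' hz hz' => simp only [map_add, hz, hz']
    | tmul x y => simp [Q.rsmul_mul]
  lsmul_mul a a' z := by
    induction z using TensorProduct.induction_on with
    | zero => simp
    | add z z' hz hz' => simp only [map_add, hz, hz']
    | tmul x y => simp [P.lsmul_mul]
  inner_lsmul a z w := by
    induction z using TensorProduct.induction_on with
    | zero => simp
    | add z z' hz hz' => simp only [map_add, LinearMap.add_apply, hz, hz']
    | tmul x y =>
      induction w using TensorProduct.induction_on with
      | zero => simp
      | add w w' hw hw' => simp only [map_add, hw, hw']
      | tmul x' y' => simp [tensorInner_tmul, P.inner_lsmul]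

lemma tensor_balanced (x : E) (b : B) (y : F) :
    (P.tensor Q).seminorm (P.rsmul b x ⊗ₜ y - x ⊗ₜ Q.lsmul b y) = 0 := by
  have h : (P.tensor Q).inner (P.rsmul b x ⊗ₜ y - x ⊗ₜ Q.lsmul b y) = 0 := by
    refine TensorProduct.ext' fun x' y' => ?_
    rw [map_sub, LinearMap.sub_apply]
    change P.tensorInner Q _ _ - P.tensorInner Q _ _ = 0
    rw [tensorInner_tmul, tensorInner_tmul, P.rsmul_inner, Q.lsmul_mul, Q.inner_lsmul, sub_self]
  rw [seminorm, h, LinearMap.zero_apply, norm_zero, Real.sqrt_zero]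

lemma tensor_seminorm_tmul_le (x : E) (y : F) :
    (P.tensor Q).seminorm (x ⊗ₜ y) ≤ P.seminorm x * Q.seminorm y := by
  refine abs_le_of_sq_le_sq' ?_ (mul_nonneg (P.seminorm_nonneg _) (Q.seminorm_nonneg _)) |>.2
  rw [mul_pow, seminorm_sq]
  calc ‖Q.inner y (Q.lsmul (P.inner x x) y)‖
      ≤ Q.seminorm y * Q.seminorm (Q.lsmul (P.inner x x) y) := Q.norm_inner_le _ _
    _ ≤ Q.seminorm y * (‖P.inner x x‖ * Q.seminorm y) :=
        mul_le_mul_of_nonneg_left (Q.seminorm_lsmul_le _ _) (Q.seminorm_nonneg _)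
    _ = P.seminorm x ^ 2 * Q.seminorm y ^ 2 := by rw [← P.seminorm_sq]; ring

end SemiCorrespondence

namespace Correspondence

variable {A B C : Type u} [NonUnitalCStarAlgebra A] [NonUnitalCStarAlgebra B]
    [NonUnitalCStarAlgebra C]

lemma seminorm_toSemi (X : Correspondence A B) (x : X.carrier) : X.toSemi.seminorm x = ‖x‖ := by
  rw [SemiCorrespondence.seminorm, ← X.norm_sq, Real.sqrt_sq (norm_nonneg _)]

lemma tensor_nondegenerate (X : Correspondence A B) (Y : Correspondence B C)
    (z : X.carrier ⊗[ℂ] Y.carrier) : ∀ ε > 0,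
      ∃ w ∈ Submodule.span ℂ {w | ∃ a x, w = (X.toSemi.tensor Y.toSemi).lsmul a x},
        (X.toSemi.tensor Y.toSemi).seminorm (z - w) < ε := by
  induction z using TensorProduct.induction_on with
  | zero =>
    intro ε hε
    exact ⟨0, zero_mem _, by simpa [SemiCorrespondence.seminorm] using hε⟩
  | add z z' hz hz' =>
    intro ε hε
    obtain ⟨w, hw, h⟩ := hz (ε / 2) (by positivity)
    obtain ⟨w', hw', h'⟩ := hz' (ε / 2) (by positivity)
    refine ⟨w + w', add_mem hw hw', ?_⟩
    have := (X.toSemi.tensor Y.toSemi).seminorm_add_le (z - w) (z' - w')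
    rw [add_sub_add_comm]
    linarith
  | tmul x y =>
    intro ε hε
    have hy : 0 < ‖y‖ + 1 := by positivity
    obtain ⟨u, hu, hxu⟩ := Metric.mem_closure_iff.1 (X.nondegenerate x) (ε / (‖y‖ + 1))
      (by positivity)
    refine ⟨u ⊗ₜ y, ?_, ?_⟩
    · have := Submodule.mem_map_of_mem
        (f := (TensorProduct.mk ℂ X.carrier Y.carrier).flip y) hu
      rw [Submodule.map_span] at this
      refine Submodule.span_mono ?_ this
      rintro _ ⟨_, ⟨a, v, rfl⟩, rfl⟩
      exact ⟨a, v ⊗ₜ y, rfl⟩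
    · rw [← TensorProduct.sub_tmul]
      refine (X.toSemi.tensor_seminorm_tmul_le Y.toSemi _ _).trans_lt ?_
      rw [seminorm_toSemi, seminorm_toSemi]
      rw [dist_eq_norm, lt_div_iff₀ hy] at hxu
      nlinarith [norm_nonneg (x - u), norm_nonneg y]

/-- The interior tensor product `X ⊗_B Y`. -/
def tensor (X : Correspondence A B) (Y : Correspondence B C) : Correspondence A C :=
  (X.toSemi.tensor Y.toSemi).completion (X.tensor_nondegenerate Y)

/-- Unitary isomorphism of correspondences: there is a surjective bimodule map which preserves the
inner products. -/
def Isomorphic (X Y : Correspondence A B) : Prop :=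
  ∃ τ : X.carrier →ₗ[ℂ] Y.carrier, Function.Surjective τ ∧
    (∀ a x, τ (X.toSemi.lsmul a x) = Y.toSemi.lsmul a (τ x)) ∧
    (∀ b x, τ (X.toSemi.rsmul b x) = Y.toSemi.rsmul b (τ x)) ∧
    ∀ x y, Y.toSemi.inner (τ x) (τ y) = X.toSemi.inner x y

/-- `X ≅ R ⊗_B S` and `S ⊗_A R ≅ Y` for some `A`-`B` correspondence `R` and `B`-`A`
correspondence `S`. -/
def ElementaryStrongShiftRelated (X : Correspondence A A) (Y : Correspondence B B) : Prop :=
  ∃ (R : Correspondence A B) (S : Correspondence B A),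
    X.Isomorphic (R.tensor S) ∧ (S.tensor R).Isomorphic Y

/-- Strong shift equivalence of correspondences with lag `m ≥ 1`: there is a chain
`X = X₀, X₁, …, X_m = Y` of correspondences over C*-algebras in which each one is elementary
strong shift related to the next. (The elementary relation is invariant under isomorphism.
The lag `0` is excluded.) -/
def StrongShiftEquivalent : ℕ → ∀ {A B : Type u} [NonUnitalCStarAlgebra A]
    [NonUnitalCStarAlgebra B], Correspondence A A → Correspondence B B → Prop
  | 0, _, _, _, _, _, _ => False
  | 1, _, _, _, _, X, Y => ElementaryStrongShiftRelated X Y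
  | m + 2, _, _, _, _, X, Y => ∃ (C : Type u) (_ : NonUnitalCStarAlgebra C)
      (Z : Correspondence C C), ElementaryStrongShiftRelated X Z ∧
        StrongShiftEquivalent (m + 1) Z Y

end Correspondence

namespace SemiCorrespondence

variable {A B E : Type u} [NonUnitalCStarAlgebra A] [NonUnitalCStarAlgebra B]
    [AddCommGroup E] [Module ℂ E]

/-- A finite-dimensional definite nondegenerate semi-correspondence is a correspondence. -/
def ofDefinite (P : SemiCorrespondence A B E) [FiniteDimensional ℂ E]
    (hP : ∀ x, P.inner x x = 0 → x = 0)
    (h : Submodule.span ℂ {z | ∃ a x, z = P.lsmul a x} = ⊤) : Correspondence A B :=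
  letI : NormedAddCommGroup P.Space := .ofSeparation fun x hx => hP x
    (norm_eq_zero.1 ((P.seminorm_sq x).symm.trans ((pow_eq_zero_iff two_ne_zero).2 hx)))
  { carrier := P.Space
    completeSpace :=
      haveI : FiniteDimensional ℂ P.Space := inferInstanceAs (FiniteDimensional ℂ E)
      FiniteDimensional.complete ℂ P.Space
    toSemi := P
    norm_sq := P.seminorm_sq
    nondegenerate := by
      have h' : (Submodule.span ℂ {z : P.Space | ∃ a x, z = P.lsmul a x}) = ⊤ := h
      intro x
      exact subset_closure (h' ▸ Submodule.mem_top) }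

end SemiCorrespondence

section Graph

variable {V W : Type u}

/-- The edges of a `V × W` matrix: `R v w` edges from `v` to `w`, for all `v` and `w`. -/
abbrev Edge (R : Matrix V W ℕ) : Type u := Σ v, Σ w, Fin (R v w)

instance [Fintype V] [Fintype W] (R : Matrix V W ℕ) : Fintype (Edge R) :=
  letI : ∀ v w, Fintype (Fin (R v w)) := fun v w => Fin.fintype (R v w)
  letI : ∀ v, Fintype (Σ w, Fin (R v w)) := fun _ => Sigma.instFintype
  Sigma.instFintype

/-- The inner product `⟨ξ, η⟩(w) = ∑ conj (ξ e) * η e`, over the edges `e` that end in `w`. -/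
def graphInner [Fintype V] (R : Matrix V W ℕ) : (Edge R → ℂ) →ₗ⋆[ℂ] (Edge R → ℂ) →ₗ[ℂ] (W → ℂ) :=
  LinearMap.mk₂'ₛₗ (starRingEnd ℂ) (RingHom.id ℂ)
    (fun ξ η w => ∑ v, ∑ k : Fin (R v w), starRingEnd ℂ (ξ ⟨v, w, k⟩) * η ⟨v, w, k⟩)
    (fun _ _ _ => by ext w; simp [add_mul, Finset.sum_add_distrib])
    (fun _ _ _ => by ext w; simp [mul_assoc, Finset.mul_sum])
    (fun _ _ _ => by ext w; simp [mul_add, Finset.sum_add_distrib])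
    (fun _ _ _ => by ext w; simp [mul_left_comm, Finset.mul_sum])

lemma graphInner_apply [Fintype V] (R : Matrix V W ℕ) (ξ η : Edge R → ℂ) (w : W) :
    graphInner R ξ η w
      = ∑ v, ∑ k : Fin (R v w), starRingEnd ℂ (ξ ⟨v, w, k⟩) * η ⟨v, w, k⟩ := rfl

lemma graphInner_self [Fintype V] (R : Matrix V W ℕ) (ξ : Edge R → ℂ) (w : W) :
    graphInner R ξ ξ w = ((∑ v, ∑ k : Fin (R v w), ‖ξ ⟨v, w, k⟩‖ ^ 2 : ℝ) : ℂ) := by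
  rw [graphInner_apply]
  push_cast
  simp only [Complex.conj_mul']

/-- The space of functions on the edges, with the structure
`(a · ξ · b)(e) = a (s e) * ξ e * b (r e)`, where the edge `e = ⟨v, w, k⟩` has source `s e = v` and
range `r e = w`. -/
def graphSemi [Fintype V] [Fintype W] (R : Matrix V W ℕ) : SemiCorrespondence (V → ℂ) (W → ℂ) (Edge R → ℂ) where
  inner := graphInner R
  lsmul := LinearMap.mk₂ ℂ (fun a ξ e => a e.1 * ξ e)
    (fun _ _ _ => by ext e; simp [add_mul]) (fun _ _ _ => by ext e; simp [mul_assoc])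
    (fun _ _ _ => by ext e; simp [mul_add]) (fun _ _ _ => by ext e; simp [mul_left_comm])
  rsmul := LinearMap.mk₂ ℂ (fun b ξ e => ξ e * b e.2.1)
    (fun _ _ _ => by ext e; simp [mul_add]) (fun _ _ _ => by ext e; simp [mul_left_comm])
    (fun _ _ _ => by ext e; simp [add_mul]) (fun _ _ _ => by ext e; simp [mul_assoc])
  star_inner ξ η := by ext w; simp [graphInner_apply, mul_comm]
  inner_self_pos ξ := by
    refine ⟨fun w => ((√(∑ v, ∑ k : Fin (R v w), ‖ξ ⟨v, w, k⟩‖ ^ 2) : ℝ) : ℂ), ?_⟩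
    ext w
    rw [graphInner_self, Pi.mul_apply, Pi.star_apply, RCLike.star_def, Complex.conj_ofReal,
      ← Complex.ofReal_mul, Real.mul_self_sqrt (by positivity)]
  inner_rsmul ξ η b := by
    ext w; simp [graphInner_apply, Finset.sum_mul, mul_assoc]
  rsmul_mul b c ξ := by ext e; simp [mul_assoc]
  lsmul_mul a a' ξ := by ext e; simp [mul_assoc]
  inner_lsmul a ξ η := by
    ext w; simp [graphInner_apply, mul_assoc, mul_left_comm]

/-- The correspondence `X(R)` of a finite `V × W` matrix with entries in `ℕ`, from the C*-algebra of
functions on `V` to that of functions on `W`. For `V = W` it is the graph correspondence. -/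
def graphCorrespondence [Fintype V] [Fintype W] (R : Matrix V W ℕ) :
    Correspondence (V → ℂ) (W → ℂ) :=
  (graphSemi R).ofDefinite
    (fun ξ hξ => by
      ext ⟨v, w, k⟩
      have h := congrFun hξ w
      change graphInner R ξ ξ w = 0 at h
      rw [graphInner_self, Complex.ofReal_eq_zero,
        Finset.sum_eq_zero_iff_of_nonneg (fun _ _ => by positivity)] at h
      have h' := h v (Finset.mem_univ v)
      rw [Finset.sum_eq_zero_iff_of_nonneg (fun _ _ => by positivity)] at h'
      simpa using h' k (Finset.mem_univ k))
    (eq_top_iff.2 fun ξ _ => Submodule.subset_span ⟨1, ξ, by ext e; simp [graphSemi]⟩)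

/-- A matrix is essential if it has no zero rows and no zero columns. -/
def IsEssential (R : Matrix V W ℕ) : Prop :=
  (∀ v, ∃ w, R v w ≠ 0) ∧ ∀ w, ∃ v, R v w ≠ 0

/-- `A = R S` and `S R = B` for some matrices `R` and `S` with entries in `ℕ`. -/
def ElementaryShiftRelated [Fintype V] [Fintype W] (A : Matrix V V ℕ) (B : Matrix W W ℕ) :
    Prop :=
  ∃ (R : Matrix V W ℕ) (S : Matrix W V ℕ), A = R * S ∧ S * R = B

/-- Strong shift equivalence of finite square matrices over `ℕ` with lag `m ≥ 1`: there is a chain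
`A = A₀, A₁, …, A_m = B` of finite square matrices over `ℕ` in which each one is elementary shift
related to the next. (The lag `0` is excluded.) -/
def MatrixStrongShiftEquivalent : ℕ → ∀ {V W : Type u} [Fintype V] [Fintype W],
    Matrix V V ℕ → Matrix W W ℕ → Prop
  | 0, _, _, _, _, _, _ => False
  | 1, _, _, _, _, A, B => ElementaryShiftRelated A B
  | m + 2, _, _, _, _, A, B => ∃ (U : Type u) (_ : Fintype U) (C : Matrix U U ℕ),
      ElementaryShiftRelated A C ∧ MatrixStrongShiftEquivalent (m + 1) C B

end Graph

end

/-! A correspondence `R` turns a Hilbert space representation `H` of its right algebra into the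
representation `R.ind H` of its left algebra on the interior tensor product, and tensor products of
correspondences become compositions of inductions (`ind_tensor_iso`). For a graph correspondence,
induction sends the evaluation at `w` to a sum of evaluations in which `v` occurs as often as there
are edges from `v` to `w` (`mult_delta`). So a matrix is the multiplicity table of induction on
irreducible representations.

From matrices to correspondences, it suffices that the correspondence of `R * S` is the tensor
product of those of `R` and `S` (`graphCorrespondence_mul_isomorphic`), because its edges are the
paths of length two.

Conversely, the intermediate C*-algebras of a chain are arbitrary, and their representations need
not split into irreducibles with finite multiplicities. The remedy is to measure a representation
`H` of such an algebra by a correspondence `T` back to the first algebra, namely the product of the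
first graph correspondence with the `R`'s passed so far. If `T.ind H` is finite dimensional, the
inner products of elements of `T` act on `H` by operators of finite rank. This gives Schur's lemma
(`Irreducible.eq_smul_id`) and finite multiplicities, and induction on the dimension of `T.ind H`
splits `H` into finitely many irreducibles and a null part, which `T` induces to zero.

A model (`IsModel`) is a family of pairwise inequivalent irreducibles on which induction by the
current correspondence has a given matrix, modulo null representations. If the current
correspondence is `R ⊗ S` and the next one is `S ⊗ R`, the irreducibles that occur in the
representations induced by `S` from the family form a model for the next one. The multiplicities of
induction by `R` and by `S` are matrices whose two products are the old and the new matrix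
(`IsModel.exists_of_elementaryStrongShiftRelated`).

At the end of the chain the model lives on the functions on `W`. Two properties that survive the
chain, that null representations vanish and all representations become generated by the family after
sufficiently many inductions, force the family to be the set of all evaluations, as `B` is essential
(`IsModel.exists_equiv`). Then the last matrix is `B` up to a bijection of the indices. -/

noncomputable section

open scoped InnerProductSpace

/-! ### Hilbert space representations -/

/-- Two families of vectors with the same Gram matrix, the first of which is total, are related by
a linear isometry. -/
lemma exists_isometry_of_gram {ι H K : Type*} [NormedAddCommGroup H] [InnerProductSpace ℂ H]
    [NormedAddCommGroup K] [InnerProductSpace ℂ K] [CompleteSpace H] [CompleteSpace K]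
    (f : ι → H) (g : ι → K) (h : ∀ i j, ⟪g i, g j⟫_ℂ = ⟪f i, f j⟫_ℂ)
    (hf : ∀ x, (∀ i, ⟪f i, x⟫_ℂ = 0) → x = 0) :
    ∃ J : H →L[ℂ] K, (∀ x y, ⟪J x, J y⟫_ℂ = ⟪x, y⟫_ℂ) ∧ ∀ i, J (f i) = g i := by
  let F : (ι →₀ ℂ) →ₗ[ℂ] H := Finsupp.linearCombination ℂ f
  let G : (ι →₀ ℂ) →ₗ[ℂ] K := Finsupp.linearCombination ℂ g
  have hFG : ∀ c d, ⟪G c, G d⟫_ℂ = ⟪F c, F d⟫_ℂ := by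
    intro c d
    simp only [F, G, Finsupp.linearCombination_apply, Finsupp.sum, sum_inner, inner_sum,
      inner_smul_left, inner_smul_right, h]
  have hdense : DenseRange F := by
    have h1 : (Submodule.span ℂ (Set.range f))ᗮ = ⊥ := by
      rw [Submodule.eq_bot_iff]
      intro x hx
      exact hf x fun i => (Submodule.mem_orthogonal _ _).1 hx _ (Submodule.subset_span ⟨i, rfl⟩)
    have h2 := (Submodule.topologicalClosure_eq_top_iff).2 h1
    rw [← Finsupp.range_linearCombination] at h2
    exact (Submodule.dense_iff_topologicalClosure_eq_top).2 h2
  have hnorm : ∃ C, ∀ c, ‖G c‖ ≤ C * ‖F c‖ := ⟨1, fun c => by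
    rw [one_mul, @norm_eq_sqrt_re_inner ℂ, @norm_eq_sqrt_re_inner ℂ, hFG]⟩
  refine ⟨G.extendOfNorm F, fun x y => ?_, fun i => ?_⟩
  · refine hdense.induction_on₂ (p := fun x y =>
      ⟪G.extendOfNorm F x, G.extendOfNorm F y⟫_ℂ = ⟪x, y⟫_ℂ)
      (isClosed_eq (by fun_prop) (by fun_prop)) (fun c d => ?_) x y
    rw [LinearMap.extendOfNorm_eq hdense hnorm, LinearMap.extendOfNorm_eq hdense hnorm, hFG]
  · have := LinearMap.extendOfNorm_eq hdense hnorm (Finsupp.single i 1)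
    simpa [F, G] using this

/-- A `*`-representation, possibly degenerate, of a C*-algebra on a Hilbert space. -/
structure HilbertRep (C : Type u) [NonUnitalCStarAlgebra C] where
  carrier : Type u
  [normedAddCommGroup : NormedAddCommGroup carrier]
  [innerProductSpace : InnerProductSpace ℂ carrier]
  [completeSpace : CompleteSpace carrier]
  act : C →⋆ₙₐ[ℂ] (carrier →L[ℂ] carrier)

attribute [instance] HilbertRep.normedAddCommGroup HilbertRep.innerProductSpace
  HilbertRep.completeSpace

namespace HilbertRep

variable {C : Type u} [NonUnitalCStarAlgebra C] (H : HilbertRep C)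

instance : CoeSort (HilbertRep C) (Type u) := ⟨HilbertRep.carrier⟩

lemma act_mul (a b : C) (x : H) : H.act (a * b) x = H.act a (H.act b x) := by
  rw [map_mul]; rfl

lemma inner_act_left (a : C) (x y : H) : ⟪H.act a x, y⟫_ℂ = ⟪x, H.act (star a) y⟫_ℂ := by
  rw [map_star, ContinuousLinearMap.star_eq_adjoint, ContinuousLinearMap.adjoint_inner_right]

lemma inner_act_right (a : C) (x y : H) : ⟪x, H.act a y⟫_ℂ = ⟪H.act (star a) x, y⟫_ℂ := by
  rw [inner_act_left, star_star]

/-- A Hilbert space representation, as a semi-correspondence to the complex numbers. -/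
def toSemi : SemiCorrespondence C (PUnit.{u + 1} → ℂ) H where
  -- The algebra `PUnit → ℂ` is a copy of the complex numbers in the universe `u`; the general
  -- tensor product of semi-correspondences thus yields induced representations.
  inner := LinearMap.mk₂'ₛₗ (starRingEnd ℂ) (RingHom.id ℂ) (fun x y _ => ⟪x, y⟫_ℂ)
    (fun _ _ _ => by ext; simp) (fun _ _ _ => by ext; simp [mul_comm])
    (fun _ _ _ => by ext; simp) (fun _ _ _ => by ext; simp)
  lsmul := LinearMap.mk₂ ℂ (fun a x => H.act a x)
    (fun _ _ _ => by simp) (fun _ _ _ => by simp) (fun _ _ _ => by simp) (fun _ _ _ => by simp)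
  rsmul := LinearMap.mk₂ ℂ (fun b x => b PUnit.unit • x)
    (fun _ _ _ => by simp [add_smul]) (fun _ _ _ => by simp [mul_smul])
    (fun _ _ _ => by simp) (fun c b x => smul_comm _ c x)
  star_inner x y := by ext; simp
  inner_self_pos x := ⟨fun _ => (‖x‖ : ℂ), by
    ext
    simp only [LinearMap.mk₂'ₛₗ_apply, Pi.mul_apply, Pi.star_apply, RCLike.star_def,
      Complex.conj_ofReal]
    rw [inner_self_eq_norm_sq_to_K, sq]; rfl⟩
  inner_rsmul x y b := by ext; simp [mul_comm]
  rsmul_mul b c x := by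
    simp only [LinearMap.mk₂_apply, Pi.mul_apply]
    rw [mul_comm, mul_smul]
  lsmul_mul a a' x := by simp
  inner_lsmul a x y := by ext; simpa using H.inner_act_left a x y

lemma toSemi_inner (x y : H) : H.toSemi.inner x y = fun _ => ⟪x, y⟫_ℂ := rfl

end HilbertRep

namespace SemiCorrespondence

variable {A E : Type u} [NonUnitalCStarAlgebra A] [AddCommGroup E] [Module ℂ E]
  (P : SemiCorrespondence A (PUnit.{u + 1} → ℂ) E)

/-- The scalar product on the completion of a semi-correspondence to the complex numbers. -/
abbrev complInnerProductSpace : InnerProductSpace ℂ P.Compl where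
  toNormedSpace := inferInstance
  inner x y := P.complInner x y PUnit.unit
  norm_sq_eq_re_inner x := by
    have h : ‖x‖ ^ 2 = ‖P.complInner x x‖ := P.compl_induction x
      (isClosed_eq (by fun_prop) (P.continuous_complInner continuous_id continuous_id).norm)
      fun x => by rw [norm_toCompl, seminorm_sq, P.complInner_toCompl]
    obtain ⟨b, hb⟩ := P.complSemi.inner_self_pos x
    change P.complInner x x = star b * b at hb
    have hc : star b * b = fun _ => ((‖b PUnit.unit‖ ^ 2 : ℝ) : ℂ) := by
      ext
      simp only [Pi.mul_apply, Pi.star_apply, RCLike.star_def, Complex.ofReal_pow]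
      rw [Complex.conj_mul']
    rw [h, hb, hc, Pi.norm_def]
    simp [-Complex.ofReal_pow]
  conj_inner_symm x y := congrFun (P.complSemi.star_inner y x) PUnit.unit
  add_left x y z := by rw [map_add]; rfl
  smul_left x y r := by rw [P.complInner.map_smulₛₗ]; rfl

/-- The Hilbert space representation obtained from a semi-correspondence to the complex numbers by
separation and completion. -/
def toHilbertRep : HilbertRep A :=
  letI := P.complInnerProductSpace
  { carrier := P.Compl
    act :=
      { toFun := fun a => ⟨P.complLsmul a, P.continuous_complLsmul a⟩
        map_smul' := fun c a => by ext x; simp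
        map_zero' := by ext x; simp
        map_add' := fun a b => by ext x; simp
        map_mul' := fun a b => by ext x; exact P.complSemi.lsmul_mul a b x
        map_star' := fun a => by
          rw [ContinuousLinearMap.star_eq_adjoint, ContinuousLinearMap.eq_adjoint_iff]
          intro x y
          have := congrFun (P.complSemi.inner_lsmul (star a) x y) PUnit.unit
          rwa [star_star] at this } }

/-- The canonical map to the Hilbert space representation of a semi-correspondence. -/
def toHilbert : E →ₗ[ℂ] P.toHilbertRep.carrier := P.toCompl

lemma inner_toHilbert (x y : E) :
    ⟪P.toHilbert x, P.toHilbert y⟫_ℂ = P.inner x y PUnit.unit :=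
  congrFun (P.complInner_toCompl x y) PUnit.unit

lemma act_toHilbert (a : A) (x : E) :
    P.toHilbertRep.act a (P.toHilbert x) = P.toHilbert (P.lsmul a x) :=
  P.complLsmul_toCompl a x

lemma denseRange_toHilbert : DenseRange P.toHilbert := P.denseRange_toCompl

end SemiCorrespondence

/-! ### Induced representations -/

namespace Correspondence

variable {A B C : Type u} [NonUnitalCStarAlgebra A] [NonUnitalCStarAlgebra B]
    [NonUnitalCStarAlgebra C]

/-- The representation of `A` induced from a representation of `B` by an `A`-`B`
correspondence. -/
def ind (R : Correspondence A B) (H : HilbertRep B) : HilbertRep A :=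
  (R.toSemi.tensor H.toSemi).toHilbertRep

/-- The elementary tensor `r ⊗ x` in the induced representation. -/
def tm (R : Correspondence A B) (H : HilbertRep B) :
    R.carrier →ₗ[ℂ] H.carrier →ₗ[ℂ] (R.ind H).carrier :=
  (TensorProduct.mk ℂ R.carrier H.carrier).compr₂ (R.toSemi.tensor H.toSemi).toHilbert

variable (R : Correspondence A B) (H : HilbertRep B)

lemma inner_tm (r r' : R.carrier) (x x' : H) :
    ⟪R.tm H r x, R.tm H r' x'⟫_ℂ = ⟪x, H.act (R.toSemi.inner r r') x'⟫_ℂ :=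
  (R.toSemi.tensor H.toSemi).inner_toHilbert _ _

lemma act_tm (a : A) (r : R.carrier) (x : H) :
    (R.ind H).act a (R.tm H r x) = R.tm H (R.toSemi.lsmul a r) x :=
  (R.toSemi.tensor H.toSemi).act_toHilbert _ _

lemma dense_span_tm :
    (Submodule.span ℂ {z | ∃ r x, R.tm H r x = z}).topologicalClosure = ⊤ := by
  rw [← Submodule.dense_iff_topologicalClosure_eq_top]
  refine (R.toSemi.tensor H.toSemi).denseRange_toHilbert.mono ?_
  rintro _ ⟨z, rfl⟩
  induction z using TensorProduct.induction_on with
  | zero => rw [map_zero]; exact zero_mem _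
  | add z z' hz hz' => rw [map_add]; exact add_mem hz hz'
  | tmul r x =>
    have h : R.tm H r x ∈ Submodule.span ℂ {z | ∃ r x, R.tm H r x = z} :=
      Submodule.subset_span ⟨r, x, rfl⟩
    exact h

variable {R H}

/-- Totality of the elementary tensors, in the form in which identities in induced representations
are checked below. -/
lemma eq_zero_of_inner_tm {z : R.ind H} (h : ∀ r x, ⟪R.tm H r x, z⟫_ℂ = 0) : z = 0 := by
  have h1 := (Submodule.topologicalClosure_eq_top_iff).1 (R.dense_span_tm H)
  rw [Submodule.eq_bot_iff] at h1
  refine h1 z ((Submodule.mem_orthogonal _ _).2 fun y hy => ?_)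
  induction hy using Submodule.span_induction with
  | mem y hy => obtain ⟨r, x, rfl⟩ := hy; exact h r x
  | zero => exact inner_zero_left _
  | add y y' _ _ hy hy' => rw [inner_add_left, hy, hy', add_zero]
  | smul c y _ hy => rw [inner_smul_left, hy, mul_zero]

end Correspondence

/-! ### Intertwiners, direct sums and multiplicities -/

namespace HilbertRep

variable {C : Type u} [NonUnitalCStarAlgebra C] {H K L H₁ H₂ : HilbertRep C}

open ContinuousLinearMap (adjoint)

/-- The space of intertwiners between two representations. -/
def hom (H K : HilbertRep C) : Submodule ℂ (H →L[ℂ] K) where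
  carrier := {φ | ∀ a x, φ (H.act a x) = K.act a (φ x)}
  zero_mem' a x := by simp
  add_mem' hφ hψ a x := by simp [hφ a x, hψ a x]
  smul_mem' c φ hφ a x := by simp [hφ a x]

lemma comp_mem_hom {φ : K →L[ℂ] L} {ψ : H →L[ℂ] K} (hφ : φ ∈ hom K L) (hψ : ψ ∈ hom H K) :
    φ ∘L ψ ∈ hom H L := fun a x => by
  rw [ContinuousLinearMap.comp_apply, hψ a x, hφ a _, ContinuousLinearMap.comp_apply]

lemma adjoint_mem_hom {φ : H →L[ℂ] K} (hφ : φ ∈ hom H K) : adjoint φ ∈ hom K H := fun a x => by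
  refine ext_inner_left ℂ fun y => ?_
  rw [ContinuousLinearMap.adjoint_inner_right, inner_act_right, inner_act_right,
    ContinuousLinearMap.adjoint_inner_right, hφ]

/-- Isometric intertwiners. -/
structure IsEmb (φ : H →L[ℂ] K) : Prop where
  mem : φ ∈ hom H K
  inner : ∀ x y, ⟪φ x, φ y⟫_ℂ = ⟪x, y⟫_ℂ

namespace IsEmb

lemma adjoint_apply {φ : H →L[ℂ] K} (hφ : IsEmb φ) (x : H) : adjoint φ (φ x) = x :=
  ext_inner_left ℂ fun y => by rw [ContinuousLinearMap.adjoint_inner_right, hφ.inner]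

lemma injective {φ : H →L[ℂ] K} (hφ : IsEmb φ) : Function.Injective φ :=
  Function.LeftInverse.injective hφ.adjoint_apply

lemma comp {φ : K →L[ℂ] L} {ψ : H →L[ℂ] K} (hφ : IsEmb φ) (hψ : IsEmb ψ) : IsEmb (φ ∘L ψ) :=
  ⟨comp_mem_hom hφ.mem hψ.mem, fun x y => by
    rw [ContinuousLinearMap.comp_apply, ContinuousLinearMap.comp_apply, hφ.inner, hψ.inner]⟩

/-- The difference of `z` and `φ (φ* z)` is orthogonal to the range of the isometry `φ`. -/
lemma surjective {φ : H →L[ℂ] K} (hφ : IsEmb φ) (h : ∀ z, (∀ x, ⟪φ x, z⟫_ℂ = 0) → z = 0) :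
    Function.Surjective φ := fun z => by
  refine ⟨adjoint φ z, (sub_eq_zero.1 (h _ fun x => ?_)).symm⟩
  rw [inner_sub_right, hφ.inner, ContinuousLinearMap.adjoint_inner_right, sub_self]

end IsEmb

/-- Unitary equivalence of representations. -/
def Iso (H K : HilbertRep C) : Prop := ∃ φ : H →L[ℂ] K, IsEmb φ ∧ Function.Surjective φ

lemma Iso.refl (H : HilbertRep C) : Iso H H :=
  ⟨ContinuousLinearMap.id ℂ H, ⟨fun _ _ => rfl, fun _ _ => rfl⟩, Function.surjective_id⟩

lemma Iso.trans (h : Iso H K) (h' : Iso K L) : Iso H L := by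
  obtain ⟨φ, hφ, hφ'⟩ := h
  obtain ⟨ψ, hψ, hψ'⟩ := h'
  exact ⟨ψ ∘L φ, hψ.comp hφ, hψ'.comp hφ'⟩

lemma Iso.symm (h : Iso H K) : Iso K H := by
  obtain ⟨φ, hφ, hφ'⟩ := h
  refine ⟨adjoint φ, ⟨adjoint_mem_hom hφ.mem, fun x y => ?_⟩, fun x => ⟨φ x, hφ.adjoint_apply x⟩⟩
  obtain ⟨x, rfl⟩ := hφ' x
  obtain ⟨y, rfl⟩ := hφ' y
  rw [hφ.adjoint_apply, hφ.adjoint_apply, hφ.inner]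

/-- On elementary tensors the algebra merely changes the label, `a · (r ⊗ x) = (a · r) ⊗ x`. With
`σ` recording this change, equivariance needs to be compared only on labels. -/
lemma exists_isEmb_of_gram {ι : Type*} (f : ι → H) (g : ι → K)
    (h : ∀ i j, ⟪g i, g j⟫_ℂ = ⟪f i, f j⟫_ℂ) (hf : ∀ x, (∀ i, ⟪f i, x⟫_ℂ = 0) → x = 0)
    (σ : C → ι → ι) (hσf : ∀ a i, H.act a (f i) = f (σ a i))
    (hσg : ∀ a i, K.act a (g i) = g (σ a i)) :
    ∃ J : H →L[ℂ] K, IsEmb J ∧ ∀ i, J (f i) = g i := by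
  obtain ⟨J, hJ, hJf⟩ := exists_isometry_of_gram f g h hf
  refine ⟨J, ⟨fun a => ?_, hJ⟩, hJf⟩
  -- Totality of `f` is stated through orthogonality, so that an operator vanishing on all `f i` is
  -- shown to be zero by way of its adjoint.
  have h : (J ∘L H.act a - K.act a ∘L J) = 0 := by
    rw [← (adjoint (𝕜 := ℂ)).map_eq_zero_iff]
    ext y
    refine hf _ fun i => ?_
    rw [ContinuousLinearMap.adjoint_inner_right, sub_apply,
      ContinuousLinearMap.comp_apply, ContinuousLinearMap.comp_apply, hσf, hJf, hJf, hσg, sub_self,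
      inner_zero_left]
  intro x
  exact sub_eq_zero.1 (congrArg (fun T : H →L[ℂ] K => T x) h)

lemma iso_of_gram {ι : Type*} (f : ι → H) (g : ι → K)
    (h : ∀ i j, ⟪g i, g j⟫_ℂ = ⟪f i, f j⟫_ℂ) (hf : ∀ x, (∀ i, ⟪f i, x⟫_ℂ = 0) → x = 0)
    (hg : ∀ x, (∀ i, ⟪g i, x⟫_ℂ = 0) → x = 0)
    (σ : C → ι → ι) (hσf : ∀ a i, H.act a (f i) = f (σ a i))
    (hσg : ∀ a i, K.act a (g i) = g (σ a i)) : Iso H K := by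
  obtain ⟨J, hJ, hJf⟩ := exists_isEmb_of_gram f g h hf σ hσf hσg
  exact ⟨J, hJ, hJ.surjective fun z hz => hg z fun i => hJf i ▸ hz (f i)⟩

/-- The maps `j₁` and `j₂` exhibit `H` as the orthogonal direct sum of `H₁` and `H₂`. -/
structure IsSum (j₁ : H₁ →L[ℂ] H) (j₂ : H₂ →L[ℂ] H) : Prop where
  left : IsEmb j₁
  right : IsEmb j₂
  orth : ∀ x y, ⟪j₁ x, j₂ y⟫_ℂ = 0
  total : ∀ h, (∀ x, ⟪j₁ x, h⟫_ℂ = 0) → (∀ y, ⟪j₂ y, h⟫_ℂ = 0) → h = 0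

namespace IsSum

variable {j₁ : H₁ →L[ℂ] H} {j₂ : H₂ →L[ℂ] H}

lemma add_eq (h : IsSum j₁ j₂) (x : H) : j₁ (adjoint j₁ x) + j₂ (adjoint j₂ x) = x := by
  refine (sub_eq_zero.1 (h.total _ (fun y => ?_) fun y => ?_)).symm
  · rw [inner_sub_right, inner_add_right, h.left.inner, h.orth,
      ContinuousLinearMap.adjoint_inner_right, add_zero, sub_self]
  · rw [inner_sub_right, inner_add_right, h.right.inner,
      ContinuousLinearMap.adjoint_inner_right, inner_eq_zero_symm.1 (h.orth _ y), zero_add,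
      sub_self]

lemma adjoint_left_right (h : IsSum j₁ j₂) (y : H₂) : adjoint j₁ (j₂ y) = 0 :=
  ext_inner_left ℂ fun x => by
    rw [ContinuousLinearMap.adjoint_inner_right, h.orth, inner_zero_right]

lemma adjoint_right_left (h : IsSum j₁ j₂) (x : H₁) : adjoint j₂ (j₁ x) = 0 :=
  ext_inner_left ℂ fun y => by
    rw [ContinuousLinearMap.adjoint_inner_right, ← inner_conj_symm, h.orth, map_zero,
      inner_zero_right]

/-- Intertwiners to a direct sum are pairs of intertwiners. -/
def homEquiv (h : IsSum j₁ j₂) (L : HilbertRep C) : hom L H ≃ₗ[ℂ] hom L H₁ × hom L H₂ where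
  toFun φ := (⟨adjoint j₁ ∘L φ.1, comp_mem_hom (adjoint_mem_hom h.left.mem) φ.2⟩,
    ⟨adjoint j₂ ∘L φ.1, comp_mem_hom (adjoint_mem_hom h.right.mem) φ.2⟩)
  invFun ψ := ⟨j₁ ∘L ψ.1.1 + j₂ ∘L ψ.2.1, add_mem (comp_mem_hom h.left.mem ψ.1.2)
    (comp_mem_hom h.right.mem ψ.2.2)⟩
  map_add' φ ψ := by
    refine Prod.ext (Subtype.ext ?_) (Subtype.ext ?_) <;> ext x <;> simp
  map_smul' c φ := by
    refine Prod.ext (Subtype.ext ?_) (Subtype.ext ?_) <;> ext x <;> simp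
  left_inv φ := by
    refine Subtype.ext ?_
    ext x
    exact h.add_eq _
  right_inv ψ := by
    refine Prod.ext (Subtype.ext ?_) (Subtype.ext ?_) <;> ext x
    · simp [h.left.adjoint_apply, h.adjoint_left_right]
    · simp [h.right.adjoint_apply, h.adjoint_right_left]

/-- The vectors of a direct sum are pairs of vectors. -/
def equivProd (h : IsSum j₁ j₂) : H ≃ₗ[ℂ] H₁ × H₂ where
  toFun x := (adjoint j₁ x, adjoint j₂ x)
  invFun y := j₁ y.1 + j₂ y.2
  map_add' _ _ := by simp
  map_smul' _ _ := by simp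
  left_inv := h.add_eq
  right_inv y := by
    simp [h.left.adjoint_apply, h.adjoint_left_right, h.right.adjoint_apply, h.adjoint_right_left]

end IsSum

/-- The restriction of a representation to a closed invariant subspace. -/
def sub (H : HilbertRep C) (K : Submodule ℂ H) (hK : IsClosed (K : Set H))
    (hinv : ∀ a, ∀ x ∈ K, H.act a x ∈ K) : HilbertRep C :=
  haveI : CompleteSpace K := hK.completeSpace_coe
  { carrier := K
    act :=
      { toFun := fun a => (H.act a ∘L K.subtypeL).codRestrict K fun x => hinv a x x.2
        map_smul' := fun c a => by ext x; simp; rfl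
        map_zero' := by ext x; simp
        map_add' := fun a b => by ext x; simp; rfl
        map_mul' := fun a b => by ext x; simp; rfl
        map_star' := fun a => by
          rw [ContinuousLinearMap.star_eq_adjoint, ContinuousLinearMap.eq_adjoint_iff]
          intro x y
          have := H.inner_act_left (star a) x y
          rwa [star_star] at this } }

/-- The inclusion of a closed invariant subspace. -/
def incl (H : HilbertRep C) (K : Submodule ℂ H) (hK : IsClosed (K : Set H))
    (hinv : ∀ a, ∀ x ∈ K, H.act a x ∈ K) : H.sub K hK hinv →L[ℂ] H := K.subtypeL

lemma act_mem_orthogonal (K : Submodule ℂ H) (hinv : ∀ a, ∀ x ∈ K, H.act a x ∈ K) (a : C) (x : H)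
    (hx : x ∈ Kᗮ) : H.act a x ∈ Kᗮ :=
  (Submodule.mem_orthogonal _ _).2 fun y hy => by
    rw [inner_act_right]
    exact (Submodule.mem_orthogonal _ _).1 hx _ (hinv _ _ hy)

section

variable (K : Submodule ℂ H) (hK : IsClosed (K : Set H)) (hinv : ∀ a, ∀ x ∈ K, H.act a x ∈ K)

lemma isEmb_incl : IsEmb (H.incl K hK hinv) := ⟨fun _ _ => rfl, fun _ _ => rfl⟩

lemma incl_mem (x : H.sub K hK hinv) : H.incl K hK hinv x ∈ K := x.2

lemma exists_incl {x : H} (hx : x ∈ K) : ∃ y, H.incl K hK hinv y = x := ⟨⟨x, hx⟩, rfl⟩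

lemma isSum_incl : IsSum (H.incl K hK hinv)
    (H.incl Kᗮ K.isClosed_orthogonal (act_mem_orthogonal K hinv)) where
  left := isEmb_incl _ _ _
  right := isEmb_incl _ _ _
  orth x y := (Submodule.mem_orthogonal _ _).1 (incl_mem _ _ _ y) _ (incl_mem _ _ _ x)
  total h h₁ h₂ := by
    have : h ∈ Kᗮ := (Submodule.mem_orthogonal _ _).2 fun y hy => h₁ ⟨y, hy⟩
    exact inner_self_eq_zero.1 (h₂ ⟨h, this⟩)

end

lemma IsEmb.isClosed_range {j : H₁ →L[ℂ] H} (hj : IsEmb j) :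
    IsClosed (j.range : Set H) := by
  have : (j.range : Set H) = {x | j (adjoint j x) = x} := by
    ext x
    refine ⟨?_, fun hx => ⟨_, hx⟩⟩
    rintro ⟨y, rfl⟩
    change j (adjoint j (j y)) = j y
    rw [hj.adjoint_apply]
  rw [this]
  exact isClosed_eq (by fun_prop) (by fun_prop)

lemma act_mem_range {j : H₁ →L[ℂ] H} (hj : j ∈ hom H₁ H) (a : C) (x : H) (hx : x ∈ j.range) :
    H.act a x ∈ j.range := by
  obtain ⟨y, rfl⟩ := hx
  exact ⟨_, hj a y⟩

lemma act_mem_ker {j : H₁ →L[ℂ] H} (hj : j ∈ hom H₁ H) (a : C) (x : H₁) (hx : x ∈ j.ker) :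
    H₁.act a x ∈ j.ker := by
  have hx : j x = 0 := hx
  change j _ = 0
  rw [hj, hx, map_zero]

lemma IsEmb.exists_isSum {j : H₁ →L[ℂ] H} (hj : IsEmb j) :
    ∃ (H₂ : HilbertRep C) (j₂ : H₂ →L[ℂ] H), IsSum j j₂ := by
  refine ⟨_, H.incl j.rangeᗮ j.range.isClosed_orthogonal
    (act_mem_orthogonal _ (act_mem_range hj.mem)), hj, isEmb_incl _ _ _, fun x y => ?_, ?_⟩
  · exact (Submodule.mem_orthogonal _ _).1 (incl_mem _ _ _ y) _ ⟨x, rfl⟩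
  · intro h h₁ h₂
    have : h ∈ j.rangeᗮ := (Submodule.mem_orthogonal _ _).2 fun y hy => by
      obtain ⟨x, rfl⟩ := hy
      exact h₁ x
    exact inner_self_eq_zero.1 (h₂ ⟨h, this⟩)

/-- Postcomposition with a unitary equivalence. -/
lemma Iso.exists_homEquiv (h : Iso H K) (L : HilbertRep C) :
    Nonempty (hom L H ≃ₗ[ℂ] hom L K) := by
  obtain ⟨φ, hφ, hs⟩ := h
  refine ⟨LinearEquiv.ofBijective
    { toFun := fun ψ => ⟨φ ∘L ψ.1, comp_mem_hom hφ.mem ψ.2⟩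
      map_add' := fun _ _ => by ext; simp
      map_smul' := fun _ _ => by ext; simp } ⟨fun ψ ψ' h => ?_, fun ψ => ?_⟩⟩
  · ext x
    exact hφ.injective (congrArg (fun T : hom L K => T.1 x) h)
  · refine ⟨⟨adjoint φ ∘L ψ.1, comp_mem_hom (adjoint_mem_hom hφ.mem) ψ.2⟩, ?_⟩
    ext x
    obtain ⟨y, hy⟩ := hs (ψ.1 x)
    simp [← hy, hφ.adjoint_apply]

/-- The dimension of the space of intertwiners. -/
def mult (L H : HilbertRep C) : ℕ := Module.finrank ℂ (hom L H)

lemma Iso.mult_eq (h : Iso H K) (L : HilbertRep C) : mult L H = mult L K := by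
  obtain ⟨e⟩ := h.exists_homEquiv L
  exact e.finrank_eq

lemma Iso.mult_eq_left (h : Iso H K) (L : HilbertRep C) : mult H L = mult K L := by
  obtain ⟨φ, hφ, hs⟩ := h
  let f : hom K L →ₗ[ℂ] hom H L :=
    { toFun := fun ψ => ⟨ψ.1 ∘L φ, comp_mem_hom ψ.2 hφ.mem⟩
      map_add' := fun _ _ => rfl
      map_smul' := fun _ _ => rfl }
  refine (LinearEquiv.ofBijective f ⟨fun ψ ψ' h => ?_, fun ψ => ?_⟩).finrank_eq.symm
  · ext x
    obtain ⟨y, rfl⟩ := hs x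
    exact congrArg (fun S : hom H L => S.1 y) h
  · refine ⟨⟨ψ.1 ∘L adjoint φ, comp_mem_hom ψ.2 (adjoint_mem_hom hφ.mem)⟩, ?_⟩
    ext x
    exact congrArg ψ.1 (hφ.adjoint_apply x)

/-- Since `finrank` is zero on infinite dimensional spaces, additivity is restricted to finite
dimensional spaces of intertwiners. -/
lemma IsSum.mult_eq {j₁ : H₁ →L[ℂ] H} {j₂ : H₂ →L[ℂ] H} (h : IsSum j₁ j₂) (L : HilbertRep C)
    [FiniteDimensional ℂ (hom L H₁)] [FiniteDimensional ℂ (hom L H₂)] :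
    mult L H = mult L H₁ + mult L H₂ := by
  rw [mult, (h.homEquiv L).finrank_eq, Module.finrank_prod]; rfl

lemma IsEmb.finiteDimensional {φ : H →L[ℂ] K} (hφ : IsEmb φ) [FiniteDimensional ℂ K] :
    FiniteDimensional ℂ H :=
  FiniteDimensional.of_injective φ.toLinearMap hφ.injective

lemma Iso.finiteDimensional (h : Iso H K) [FiniteDimensional ℂ H] : FiniteDimensional ℂ K := by
  obtain ⟨φ, hφ, -⟩ := h.symm
  exact hφ.finiteDimensional

end HilbertRep

/-! ### Functoriality of induction -/

namespace Correspondence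

open HilbertRep ContinuousLinearMap

variable {A B C : Type u} [NonUnitalCStarAlgebra A] [NonUnitalCStarAlgebra B]
    [NonUnitalCStarAlgebra C] (R : Correspondence A B) {H K : HilbertRep B}

/-- For an isometric intertwiner `j`, the families `r ⊗ x` and `r ⊗ j x` have the same Gram matrix.
Isometric intertwiners suffice below, because nonzero intertwiners from the relevant irreducibles
are multiples of such. -/
lemma exists_ind_map {j : H →L[ℂ] K} (hj : IsEmb j) :
    ∃ J : R.ind H →L[ℂ] R.ind K, IsEmb J ∧ ∀ r x, J (R.tm H r x) = R.tm K r (j x) := by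
  obtain ⟨J, hJ, hJf⟩ := exists_isEmb_of_gram (H := R.ind H) (K := R.ind K)
    (fun p : R.carrier × H => R.tm H p.1 p.2) (fun p => R.tm K p.1 (j p.2))
    (fun p q => by rw [inner_tm, inner_tm, ← hj.mem, hj.inner])
    (fun z hz => eq_zero_of_inner_tm fun r x => hz (r, x))
    (fun a p => (R.toSemi.lsmul a p.1, p.2)) (fun a p => act_tm _ _ _ _ _)
    (fun a p => act_tm _ _ _ _ _)
  exact ⟨J, hJ, fun r x => hJf (r, x)⟩

lemma ind_iso (h : Iso H K) : Iso (R.ind H) (R.ind K) := by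
  obtain ⟨j, hj, hs⟩ := h
  obtain ⟨J, hJ, hJf⟩ := R.exists_ind_map hj
  refine ⟨J, hJ, hJ.surjective fun z hz => eq_zero_of_inner_tm fun r y => ?_⟩
  obtain ⟨x, rfl⟩ := hs y
  rw [← hJf, hz]

/-- Orthogonality is `⟨r ⊗ j₁ x, r' ⊗ j₂ y⟩ = ⟨j₁ x, j₂ (⟨r, r'⟩ y)⟩ = 0`, and totality follows by
splitting `x` in `r ⊗ x` into its two components. -/
lemma ind_isSum {H₁ H₂ : HilbertRep B} {j₁ : H₁ →L[ℂ] H} {j₂ : H₂ →L[ℂ] H} (h : IsSum j₁ j₂) :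
    ∃ (J₁ : R.ind H₁ →L[ℂ] R.ind H) (J₂ : R.ind H₂ →L[ℂ] R.ind H), IsSum J₁ J₂ := by
  obtain ⟨J₁, hJ₁, e₁⟩ := R.exists_ind_map h.left
  obtain ⟨J₂, hJ₂, e₂⟩ := R.exists_ind_map h.right
  refine ⟨J₁, J₂, hJ₁, hJ₂, fun x y => ?_, fun z h₁ h₂ => ?_⟩
  · have : adjoint J₁ (J₂ y) = 0 := eq_zero_of_inner_tm fun r x => by
      rw [adjoint_inner_right, e₁, ← adjoint_inner_left]
      have : adjoint J₂ (R.tm H r (j₁ x)) = 0 := eq_zero_of_inner_tm fun r' x' => by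
        rw [adjoint_inner_right, e₂, inner_tm, ← h.left.mem, ← inner_conj_symm, h.orth, map_zero]
      rw [this, inner_zero_left]
    rw [← adjoint_inner_right, this, inner_zero_right]
  · refine eq_zero_of_inner_tm fun r x => ?_
    rw [← h.add_eq x, map_add, inner_add_left, ← e₁, ← e₂, h₁, h₂, add_zero]

lemma Isomorphic.ind_iso {X Y : Correspondence A B} (h : X.Isomorphic Y) (H : HilbertRep B) :
    Iso (X.ind H) (Y.ind H) := by
  obtain ⟨τ, hs, hl, -, hi⟩ := h
  refine iso_of_gram (fun p : X.carrier × H => X.tm H p.1 p.2) (fun p => Y.tm H (τ p.1) p.2)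
    (fun p q => by rw [inner_tm, inner_tm, hi])
    (fun z hz => eq_zero_of_inner_tm fun r x => hz (r, x))
    (fun z hz => eq_zero_of_inner_tm fun r x => ?_)
    (fun a p => (X.toSemi.lsmul a p.1, p.2)) (fun a p => act_tm _ _ _ _ _)
    (fun a p => ?_)
  · obtain ⟨r, rfl⟩ := hs r
    exact hz (r, x)
  · rw [act_tm, hl]

variable {R}

/-- This bound makes `r ⊗ x` continuous in both variables. Continuity in `r` serves limits in a
completed correspondence, and continuity in `x` provides the adjoint of `x ↦ r ⊗ x`. -/
lemma norm_tm_le (r : R.carrier) (x : H) : ‖R.tm H r x‖ ≤ ‖r‖ * ‖x‖ := by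
  have h₁ : H.toSemi.seminorm x = ‖x‖ := by
    rw [SemiCorrespondence.seminorm, toSemi_inner, Pi.norm_def]
    simp [inner_self_eq_norm_sq_to_K]
  have h₂ : ‖R.tm H r x‖ = (R.toSemi.tensor H.toSemi).seminorm (r ⊗ₜ x) :=
    (R.toSemi.tensor H.toSemi).norm_toCompl _
  rw [h₂, ← R.seminorm_toSemi, ← h₁]
  exact SemiCorrespondence.tensor_seminorm_tmul_le _ _ _ _

variable (R H) in
/-- The map `(r, x) ↦ r ⊗ x`, as a continuous bilinear map. -/
def tmL : R.carrier →L[ℂ] H →L[ℂ] R.ind H :=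
  LinearMap.mkContinuous₂ (R.tm H) 1 fun r x => by rw [one_mul]; exact norm_tm_le r x

lemma tmL_apply (r : R.carrier) (x : H) : R.tmL H r x = R.tm H r x := rfl

/-- The vectors `(r ⊗ s) ⊗ x` and `r ⊗ (s ⊗ x)` have the same Gram matrix, and both families are
total. -/
lemma ind_tensor_iso (R : Correspondence A B) (S : Correspondence B C) (H : HilbertRep C) :
    Iso ((R.tensor S).ind H) (R.ind (S.ind H)) := by
  let q : R.carrier → S.carrier → (R.tensor S).carrier :=
    fun r s => (R.toSemi.tensor S.toSemi).toCompl (r ⊗ₜ s)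
  have hq : ∀ r s r' s', (R.tensor S).toSemi.inner (q r s) (q r' s')
      = S.toSemi.inner s (S.toSemi.lsmul (R.toSemi.inner r r') s') := fun r s r' s' =>
    (R.toSemi.tensor S.toSemi).complInner_toCompl _ _
  refine iso_of_gram (fun p : R.carrier × S.carrier × H => (R.tensor S).tm H (q p.1 p.2.1) p.2.2)
    (fun p => R.tm (S.ind H) p.1 (S.tm H p.2.1 p.2.2)) (fun p p' => ?_) (fun z hz => ?_)
    (fun z hz => ?_) (fun a p => (R.toSemi.lsmul a p.1, p.2.1, p.2.2)) (fun a p => ?_)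
    (fun a p => ?_)
  · rw [inner_tm, inner_tm, act_tm, inner_tm, hq]
  · refine eq_zero_of_inner_tm fun y x => ?_
    refine (R.toSemi.tensor S.toSemi).compl_induction y
      (isClosed_eq (f := fun y : (R.tensor S).carrier => ⟪(R.tensor S).tmL H y x, z⟫_ℂ)
        (g := fun _ => 0) (by fun_prop) (by fun_prop)) fun y => ?_
    induction y using TensorProduct.induction_on with
    | zero =>
      rw [map_zero]
      exact (congrArg (fun v => ⟪v, z⟫_ℂ) (LinearMap.map_zero₂ ((R.tensor S).tm H) x)).trans
        (inner_zero_left z)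
    | add y y' hy hy' =>
      rw [map_add]
      refine (congrArg (fun v => ⟪v, z⟫_ℂ) (LinearMap.map_add₂ ((R.tensor S).tm H) _ _ x)).trans ?_
      rw [inner_add_left, hy, hy', add_zero]
    | tmul r s => exact hz (r, s, x)
  · refine eq_zero_of_inner_tm fun r y => ?_
    rw [← tmL_apply, ← adjoint_inner_right]
    -- Totality in two stages: the adjoint of `y ↦ r ⊗ y` maps `z` to a vector orthogonal to all `s
    -- ⊗ x`.
    have : adjoint (R.tmL (S.ind H) r) z = 0 := eq_zero_of_inner_tm fun s x => by
      rw [adjoint_inner_right]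
      exact hz (r, s, x)
    rw [this, inner_zero_right]
  · rw [act_tm]
    exact congrArg (fun v => (R.tensor S).tm H v p.2.2)
      ((R.toSemi.tensor S.toSemi).complLsmul_toCompl _ _)
  · rw [act_tm]

lemma Isomorphic.ind_tensor_iso {X : Correspondence A C} {R : Correspondence A B}
    {S : Correspondence B C} (h : X.Isomorphic (R.tensor S)) (H : HilbertRep C) :
    Iso (X.ind H) (R.ind (S.ind H)) :=
  (h.ind_iso H).trans (Correspondence.ind_tensor_iso R S H)

end Correspondence

namespace Correspondence

open HilbertRep ContinuousLinearMap

variable {D C : Type u} [NonUnitalCStarAlgebra D] [NonUnitalCStarAlgebra C]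
  (T : Correspondence D C) {H K L : HilbertRep C}

/-! ### Vectors annihilated by induction -/

/-- The vectors of a representation that are annihilated by all inner products of elements of the
correspondence `T`, that is, those with `t ⊗ x = 0` for all `t`. -/
def nullVec (H : HilbertRep C) : Submodule ℂ H where
  carrier := {x | ∀ t t', H.act (T.toSemi.inner t t') x = 0}
  zero_mem' t t' := map_zero _
  add_mem' hx hy t t' := by rw [map_add, hx, hy, add_zero]
  smul_mem' c x hx t t' := by rw [map_smul, hx, smul_zero]

variable {T}

lemma mem_nullVec {x : H} : x ∈ T.nullVec H ↔ ∀ t t', H.act (T.toSemi.inner t t') x = 0 := Iff.rfl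

lemma mem_nullVec_iff_tm {x : H} : x ∈ T.nullVec H ↔ ∀ t, T.tm H t x = 0 := by
  refine ⟨fun h t => ?_, fun h t t' => ?_⟩
  · rw [← inner_self_eq_zero (𝕜 := ℂ), inner_tm, h, inner_zero_right]
  · refine ext_inner_left ℂ fun y => ?_
    rw [← inner_tm, h, inner_zero_right, inner_zero_right]

lemma isClosed_nullVec : IsClosed (T.nullVec H : Set H) := by
  have : (T.nullVec H : Set H) = ⋂ t, ⋂ t', {x | H.act (T.toSemi.inner t t') x = 0} := by
    ext x; simp [mem_nullVec]
  rw [this]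
  exact isClosed_iInter fun t => isClosed_iInter fun t' =>
    isClosed_eq (by fun_prop) (by fun_prop)

lemma act_mem_nullVec (a : C) (x : H) (hx : x ∈ T.nullVec H) : H.act a x ∈ T.nullVec H :=
  fun t t' => by rw [← act_mul, ← T.toSemi.inner_rsmul, hx]

lemma map_mem_nullVec {φ : H →L[ℂ] K} (hφ : φ ∈ hom H K) {x : H} (hx : x ∈ T.nullVec H) :
    φ x ∈ T.nullVec K := fun t t' => by rw [← hφ, hx, map_zero]

lemma mem_nullVec_of_map {φ : H →L[ℂ] K} (hφ : IsEmb φ) {x : H} (hx : φ x ∈ T.nullVec K) :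
    x ∈ T.nullVec H := fun t t' => hφ.injective (by rw [hφ.mem, hx, map_zero])

variable (T) in
/-- The representations which induce to the zero representation. -/
def Null (H : HilbertRep C) : Prop := ∀ x : H, x ∈ T.nullVec H

lemma null_iff_ind : T.Null H ↔ ∀ z : T.ind H, z = 0 := by
  refine ⟨fun h z => eq_zero_of_inner_tm fun t x => ?_, fun h x => mem_nullVec_iff_tm.2 fun t => h _⟩
  rw [mem_nullVec_iff_tm.1 (h x), inner_zero_left]

lemma Null.of_isEmb {φ : H →L[ℂ] K} (hφ : IsEmb φ) (h : T.Null K) : T.Null H :=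
  fun _ => mem_nullVec_of_map hφ (h _)

lemma Null.of_iso (e : Iso H K) (h : T.Null K) : T.Null H := by
  obtain ⟨φ, hφ, -⟩ := e
  exact h.of_isEmb hφ

lemma null_tensor {B : Type u} [NonUnitalCStarAlgebra B] {R : Correspondence C B}
    {H : HilbertRep B} : (T.tensor R).Null H ↔ T.Null (R.ind H) := by
  rw [null_iff_ind, null_iff_ind]
  obtain ⟨φ, hφ, hs⟩ := ind_tensor_iso T R H
  refine ⟨fun h z => ?_, fun h z => hφ.injective (by rw [h (φ z), map_zero])⟩
  obtain ⟨y, rfl⟩ := hs z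
  rw [h y, map_zero]

lemma finrank_ind_pos [FiniteDimensional ℂ (T.ind H)] (h : ¬ T.Null H) :
    0 < Module.finrank ℂ (T.ind H) := by
  rw [null_iff_ind] at h
  push Not at h
  obtain ⟨z, hz⟩ := h
  have : Nontrivial (T.ind H) := ⟨z, 0, hz⟩
  exact Module.finrank_pos

lemma finiteDimensional_ind_of_isEmb {φ : H →L[ℂ] K} (hφ : IsEmb φ)
    [FiniteDimensional ℂ (T.ind K)] : FiniteDimensional ℂ (T.ind H) := by
  obtain ⟨J, hJ, -⟩ := T.exists_ind_map hφ
  exact hJ.finiteDimensional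

/-- The dimension of `T.ind H` serves as the size of `H`. It is additive, and by `finrank_ind_pos`
it drops strictly when a summand that is not null is split off. -/
lemma finrank_ind_eq {H₁ H₂ : HilbertRep C} {j₁ : H₁ →L[ℂ] H} {j₂ : H₂ →L[ℂ] H}
    (h : IsSum j₁ j₂) [FiniteDimensional ℂ (T.ind H)] :
    Module.finrank ℂ (T.ind H) = Module.finrank ℂ (T.ind H₁) + Module.finrank ℂ (T.ind H₂) := by
  obtain ⟨J₁, J₂, hJ⟩ := T.ind_isSum h
  have := hJ.left.finiteDimensional
  have := hJ.right.finiteDimensional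
  rw [hJ.equivProd.finrank_eq, Module.finrank_prod]

end Correspondence

namespace HilbertRep

open Correspondence ContinuousLinearMap

variable {D C : Type u} [NonUnitalCStarAlgebra D] [NonUnitalCStarAlgebra C]
  {T : Correspondence D C} {H K L : HilbertRep C}

/-! ### Irreducible representations -/

/-- A representation is irreducible if it has no closed invariant subspaces other than `⊥`
and `⊤`. (The zero representation is not excluded.) -/
def Irreducible (H : HilbertRep C) : Prop :=
  ∀ K : Submodule ℂ H, IsClosed (K : Set H) → (∀ a, ∀ x ∈ K, H.act a x ∈ K) → K = ⊥ ∨ K = ⊤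

lemma Irreducible.eq_zero (hH : Irreducible H) {φ : H →L[ℂ] K} (hφ : φ ∈ hom H K) {x : H}
    (hx : x ≠ 0) (h : φ x = 0) : φ = 0 := by
  rcases hH φ.ker φ.isClosed_ker (act_mem_ker hφ) with h0 | h1
  · have : x ∈ φ.ker := h
    rw [h0] at this
    exact absurd this hx
  · ext y
    have : y ∈ φ.ker := h1 ▸ Submodule.mem_top
    exact this

lemma exists_act_ne_zero (h : ¬ T.Null H) : ∃ t t' x, H.act (T.toSemi.inner t t') x ≠ 0 := by
  by_contra! h'
  exact h fun x t t' => h' t t' x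

/-- The action of `⟨t, t'⟩` is the map `x ↦ t' ⊗ x` followed by the adjoint of `x ↦ t ⊗ x`, so it
factors through the finite dimensional space `T.ind H`. -/
lemma finiteDimensional_range_act [FiniteDimensional ℂ (T.ind H)] (t t' : T.carrier) :
    FiniteDimensional ℂ (H.act (T.toSemi.inner t t')).range := by
  have h : (H.act (T.toSemi.inner t t')).range ≤ (adjoint (T.tmL H t)).range := by
    rintro _ ⟨x, rfl⟩
    refine ⟨T.tmL H t' x, ext_inner_left ℂ fun y => ?_⟩
    exact (adjoint_inner_right _ _ _).trans (inner_tm _ _ _ _ _ _)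
  have : FiniteDimensional ℂ (adjoint (T.tmL H t)).range :=
    inferInstanceAs (FiniteDimensional ℂ (LinearMap.range (adjoint (T.tmL H t)).toLinearMap))
  exact Submodule.finiteDimensional_of_le h

/-- Schur's lemma. -/
lemma Irreducible.eq_smul_id (hH : Irreducible H) (hT : ¬ T.Null H)
    [FiniteDimensional ℂ (T.ind H)] {φ : H →L[ℂ] H} (hφ : φ ∈ hom H H) :
    ∃ c : ℂ, φ = c • ContinuousLinearMap.id ℂ H := by
  obtain ⟨t, t', x, hx⟩ := exists_act_ne_zero hT
  have := finiteDimensional_range_act (H := H) t t'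
  set b := T.toSemi.inner t t'
  -- Since `φ` commutes with the action of `b`, it preserves the nonzero finite dimensional range of
  -- `b` and has an eigenvalue `c` there. Then `φ - c` has a nonzero kernel, and irreducibility
  -- makes it zero.
  have hinv : ∀ y ∈ (H.act b).range, φ.toLinearMap y ∈ (H.act b).range := by
    rintro _ ⟨y, rfl⟩
    exact ⟨φ y, (hφ b y).symm⟩
  have : Nontrivial (H.act b).range :=
    ⟨⟨⟨H.act b x, x, rfl⟩, 0, fun h => hx (congrArg Subtype.val h)⟩⟩
  obtain ⟨c, hc⟩ := Module.End.exists_eigenvalue (φ.toLinearMap.restrict hinv)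
  obtain ⟨v, hv⟩ := hc.exists_hasEigenvector
  refine ⟨c, sub_eq_zero.1 (hH.eq_zero (x := v.1) ?_ (fun h => hv.2 (Subtype.ext h)) ?_)⟩
  · exact sub_mem hφ ((hom H H).smul_mem c fun _ _ => rfl)
  · have := congrArg Subtype.val hv.apply_eq_smul
    exact sub_eq_zero.2 this

/-- An intertwiner is determined by its value at one nonzero vector `⟨t, t'⟩ x`, and this value lies
in the range of `⟨t, t'⟩` on `H`, which is finite dimensional. -/
lemma Irreducible.finiteDimensional_hom (hL : Irreducible L) (hT : ¬ T.Null L)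
    [FiniteDimensional ℂ (T.ind H)] : FiniteDimensional ℂ (hom L H) := by
  obtain ⟨t, t', x, hx⟩ := exists_act_ne_zero hT
  have := finiteDimensional_range_act (H := H) t t'
  let f : hom L H →ₗ[ℂ] (H.act (T.toSemi.inner t t')).range :=
    { toFun := fun φ => ⟨φ.1 (L.act (T.toSemi.inner t t') x), φ.1 x, (φ.2 _ _).symm⟩
      map_add' := fun _ _ => rfl
      map_smul' := fun _ _ => rfl }
  refine FiniteDimensional.of_injective f ((injective_iff_map_eq_zero f).2 fun φ hφ => ?_)
  exact Subtype.ext (hL.eq_zero φ.2 hx (congrArg Subtype.val hφ))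

/-- By Schur's lemma `φ* φ` is a scalar `c`. Evaluation at a vector `y` with `φ y ≠ 0` shows `c >
0`, and `φ` is divided by the square root of `c`. -/
lemma Irreducible.exists_isEmb (hL : Irreducible L) (hT : ¬ T.Null L)
    [FiniteDimensional ℂ (T.ind L)] {φ : L →L[ℂ] H} (hφ : φ ∈ hom L H) (h0 : φ ≠ 0) :
    ∃ s : ℂ, s ≠ 0 ∧ IsEmb (s • φ) := by
  obtain ⟨c, hc⟩ := hL.eq_smul_id hT (comp_mem_hom (adjoint_mem_hom hφ) hφ)
  have hin : ∀ x y, ⟪φ x, φ y⟫_ℂ = c * ⟪x, y⟫_ℂ := fun x y => by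
    rw [← adjoint_inner_right]
    change ⟪x, (adjoint φ ∘L φ) y⟫_ℂ = _
    rw [hc]
    simp
  obtain ⟨y, hy⟩ : ∃ y, φ y ≠ 0 := by
    by_contra! h
    exact h0 (ContinuousLinearMap.ext h)
  have hy0 : y ≠ 0 := fun h => hy (by rw [h, map_zero])
  set r : ℝ := ‖φ y‖ ^ 2 / ‖y‖ ^ 2 with hr
  have hrpos : 0 < r := div_pos (pow_pos (norm_pos_iff.2 hy) 2) (pow_pos (norm_pos_iff.2 hy0) 2)
  have hcr : c = r := by
    have h := hin y y
    rw [inner_self_eq_norm_sq_to_K, inner_self_eq_norm_sq_to_K] at h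
    have hne : ((‖y‖ : ℂ) ^ 2) ≠ 0 := pow_ne_zero 2 (by simpa using hy0)
    rw [hr]
    push_cast
    exact (eq_div_iff hne).2 h.symm
  have hs : √r ≠ 0 := (Real.sqrt_pos.2 hrpos).ne'
  refine ⟨((√r)⁻¹ : ℝ), by simpa using hs, (hom L H).smul_mem _ hφ, fun x z => ?_⟩
  rw [smul_apply, smul_apply, inner_smul_left, inner_smul_right, hin, hcr, Complex.conj_ofReal,
    ← mul_assoc, ← mul_assoc, ← Complex.ofReal_mul, ← Complex.ofReal_mul]
  have : (√r)⁻¹ * (√r)⁻¹ * r = 1 := by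
    rw [← mul_inv, Real.mul_self_sqrt hrpos.le, inv_mul_cancel₀ hrpos.ne']
  rw [this, Complex.ofReal_one, one_mul]

lemma Irreducible.surjective (hK : Irreducible K) {j : L →L[ℂ] K} (hj : IsEmb j) {x : L}
    (hx : x ≠ 0) : Function.Surjective j := by
  rcases hK _ hj.isClosed_range (act_mem_range hj.mem) with h | h
  · have : j x ∈ j.range := ⟨x, rfl⟩
    rw [h, Submodule.mem_bot] at this
    exact absurd (hj.injective (this.trans (map_zero j).symm)) hx
  · exact LinearMap.range_eq_top.1 h

lemma Irreducible.iso_of_ne_zero (hL : Irreducible L) (hT : ¬ T.Null L)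
    [FiniteDimensional ℂ (T.ind L)] (hK : Irreducible K) {φ : L →L[ℂ] K} (hφ : φ ∈ hom L K)
    (h0 : φ ≠ 0) : Iso L K := by
  obtain ⟨t, t', x, hx⟩ := exists_act_ne_zero hT
  obtain ⟨s, hs, hj⟩ := hL.exists_isEmb hT hφ h0
  exact ⟨s • φ, hj, hK.surjective hj hx⟩

lemma Irreducible.mult_eq_zero (hL : Irreducible L) (hT : ¬ T.Null L)
    [FiniteDimensional ℂ (T.ind L)] (hK : Irreducible K) (h : ¬ Iso L K) : mult L K = 0 := by
  have : Subsingleton (hom L K) := by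
    refine subsingleton_of_forall_eq 0 fun φ => Subtype.ext ?_
    by_contra h0
    exact h (hL.iso_of_ne_zero hT hK φ.2 h0)
  exact Module.finrank_zero_of_subsingleton

lemma Irreducible.mult_self (hL : Irreducible L) (hT : ¬ T.Null L)
    [FiniteDimensional ℂ (T.ind L)] : mult L L = 1 := by
  obtain ⟨t, t', x, hx⟩ := exists_act_ne_zero hT
  refine finrank_eq_one_iff'.2 ⟨⟨ContinuousLinearMap.id ℂ L, fun _ _ => rfl⟩, fun h => ?_,
    fun φ => ?_⟩
  · exact hx (congrArg (fun S : hom L L => S.1 _) h)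
  · obtain ⟨c, hc⟩ := hL.eq_smul_id hT φ.2
    exact ⟨c, Subtype.ext hc.symm⟩

lemma Irreducible.hom_eq_zero_of_null (hL : Irreducible L) (hT : ¬ T.Null L) (hH : T.Null H)
    {φ : L →L[ℂ] H} (hφ : φ ∈ hom L H) : φ = 0 := by
  obtain ⟨t, t', x, hx⟩ := exists_act_ne_zero hT
  exact hL.eq_zero hφ hx (by rw [hφ, hH])

lemma Irreducible.mult_eq_zero_of_null (hL : Irreducible L) (hT : ¬ T.Null L) (hH : T.Null H) :
    mult L H = 0 := by
  have : Subsingleton (hom L H) :=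
    subsingleton_of_forall_eq 0 fun φ => Subtype.ext (hL.hom_eq_zero_of_null hT hH φ.2)
  exact Module.finrank_zero_of_subsingleton

/-- A representation which does not induce to zero, but to a finite dimensional representation,
has an irreducible subrepresentation with the first of these properties. -/
lemma exists_irreducible_isEmb [FiniteDimensional ℂ (T.ind H)] (hT : ¬ T.Null H) :
    ∃ (L : HilbertRep C) (j : L →L[ℂ] H), IsEmb j ∧ Irreducible L ∧ ¬ T.Null L := by
  induction hn : Module.finrank ℂ (T.ind H) using Nat.strong_induction_on generalizing H with
  | _ n ih =>
  -- The orthogonal complement `L₀` of the null vectors of `H` contains no nonzero null vectors, so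
  -- none of its nonzero subrepresentations is null.
  have hS := isSum_incl (T.nullVec H) isClosed_nullVec act_mem_nullVec
  set L₀ := H.sub (T.nullVec H)ᗮ (Submodule.isClosed_orthogonal _)
    (act_mem_orthogonal _ act_mem_nullVec)
  have := finiteDimensional_ind_of_isEmb (T := T) hS.right
  have hL₀ : ∀ x ∈ T.nullVec L₀, x = 0 := fun x hx => by
    refine hS.right.injective ?_
    have h₁ := map_mem_nullVec hS.right.mem hx
    have h₂ := (Submodule.mem_orthogonal _ _).1 (incl_mem _ _ _ x) _ h₁
    rw [map_zero, ← inner_self_eq_zero (𝕜 := ℂ)]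
    exact h₂
  have hL₀T : ¬ T.Null L₀ := fun h => hT fun x => by
    rw [← hS.add_eq x, hL₀ _ (h (adjoint _ x)), map_zero, add_zero]
    exact incl_mem _ _ _ _
  by_cases hirr : Irreducible L₀
  · exact ⟨L₀, _, hS.right, hirr, hL₀T⟩
  unfold Irreducible at hirr
  push Not at hirr
  obtain ⟨K, hKc, hKi, hK₀, hK₁⟩ := hirr
  have hS' := isSum_incl K hKc hKi
  -- A proper invariant subspace and its complement are both nonzero, hence not null. Each has a
  -- strictly smaller induced dimension than `L₀`, and the induction hypothesis applies to the
  -- subspace.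
  have h₁ : ¬ T.Null (L₀.sub K hKc hKi) := fun h => hK₀ ((Submodule.eq_bot_iff _).2 fun x hx => by
    obtain ⟨y, rfl⟩ := exists_incl K hKc hKi hx
    exact hL₀ _ (map_mem_nullVec hS'.left.mem (h y)))
  have h₂ : ¬ T.Null (L₀.sub Kᗮ K.isClosed_orthogonal (act_mem_orthogonal K hKi)) := fun h => by
    have := hKc.completeSpace_coe
    refine hK₁ ((Submodule.orthogonal_eq_bot_iff).1 ((Submodule.eq_bot_iff _).2 fun x hx => ?_))
    obtain ⟨y, rfl⟩ := exists_incl Kᗮ K.isClosed_orthogonal (act_mem_orthogonal K hKi) hx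
    exact hL₀ _ (map_mem_nullVec hS'.right.mem (h y))
  have := finiteDimensional_ind_of_isEmb (T := T) hS'.left
  have := finiteDimensional_ind_of_isEmb (T := T) hS'.right
  have h₃ := finrank_ind_eq (T := T) hS
  have h₄ := finrank_ind_eq (T := T) hS'
  have h₅ := finrank_ind_pos h₂
  obtain ⟨L, j, hj, hL⟩ := ih _ (by rw [← hn, h₃, h₄]; omega) h₁ rfl
  exact ⟨L, _, (hS.right.comp hS'.left).comp hj, hL⟩

/-! ### Representations generated by a family of irreducible representations -/

/-- The representation `H` is generated by the images of the representations `π u` and by the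
vectors annihilated by `T`. -/
def Gen (T : Correspondence D C) {U : Type*} (π : U → HilbertRep C) (H : HilbertRep C) : Prop :=
  ∀ h : H, (∀ u, ∀ φ ∈ hom (π u) H, ∀ x, ⟪φ x, h⟫_ℂ = 0) →
    (∀ x ∈ T.nullVec H, ⟪x, h⟫_ℂ = 0) → h = 0

section Gen

variable {U U' : Type*} {π : U → HilbertRep C} {π' : U' → HilbertRep C}

/-- The adjoint of the embedding carries intertwiners into `H` and null vectors of `H` to those of
the subrepresentation. -/
lemma Gen.of_isEmb (h : Gen T π H) {j : L →L[ℂ] H} (hj : IsEmb j) : Gen T π L := by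
  intro x h₁ h₂
  refine hj.injective ?_
  rw [map_zero]
  refine h _ (fun u φ hφ y => ?_) fun y hy => ?_
  · rw [← adjoint_inner_left]
    exact h₁ u _ (comp_mem_hom (adjoint_mem_hom hj.mem) hφ) y
  · rw [← adjoint_inner_left]
    exact h₂ _ (map_mem_nullVec (adjoint_mem_hom hj.mem) hy)

lemma Gen.of_iso (h : Gen T π H) (e : Iso L H) : Gen T π L := by
  obtain ⟨φ, hφ, -⟩ := e
  exact h.of_isEmb hφ

lemma Gen.mono (h : Gen T π H) (hπ : ∀ u, ∃ u', Iso (π u) (π' u')) : Gen T π' H := by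
  intro x h₁ h₂
  refine h x (fun u φ hφ y => ?_) h₂
  obtain ⟨u', e⟩ := hπ u
  obtain ⟨ψ, hψ, hs⟩ := e.symm
  obtain ⟨y, rfl⟩ := hs y
  exact h₁ u' _ (comp_mem_hom hφ hψ.mem) y

lemma Gen.of_isSum {H₁ H₂ : HilbertRep C} {j₁ : H₁ →L[ℂ] H} {j₂ : H₂ →L[ℂ] H}
    (h : IsSum j₁ j₂) (h₁ : Gen T π H₁) (h₂ : Gen T π H₂) : Gen T π H := by
  intro x hπ hN
  rw [← h.add_eq x]
  have e₁ : adjoint j₁ x = 0 := by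
    refine h₁ _ (fun u φ hφ y => ?_) fun y hy => ?_
    · rw [adjoint_inner_right]; exact hπ u _ (comp_mem_hom h.left.mem hφ) y
    · rw [adjoint_inner_right]; exact hN _ (map_mem_nullVec h.left.mem hy)
  have e₂ : adjoint j₂ x = 0 := by
    refine h₂ _ (fun u φ hφ y => ?_) fun y hy => ?_
    · rw [adjoint_inner_right]; exact hπ u _ (comp_mem_hom h.right.mem hφ) y
    · rw [adjoint_inner_right]; exact hN _ (map_mem_nullVec h.right.mem hy)
  rw [e₁, e₂, map_zero, map_zero, add_zero]

lemma gen_self (u : U) : Gen T π (π u) := fun h h₁ _ =>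
  inner_self_eq_zero.1 (h₁ u (ContinuousLinearMap.id ℂ _) (fun _ _ => rfl) h)

lemma gen_of_null (h : T.Null H) : Gen T π H := fun x _ h₂ =>
  inner_self_eq_zero.1 (h₂ x (h x))

/-- A representation that is generated by a family of irreducible representations, and induces to
a finite dimensional representation, is built from finitely many members of the family and from a
representation that induces to zero. -/
lemma Gen.induction (hirr : ∀ u, Irreducible (π u)) (hπT : ∀ u, ¬ T.Null (π u))
    (hfin : ∀ u, FiniteDimensional ℂ (T.ind (π u))) {P : HilbertRep C → Prop}
    (null : ∀ H, T.Null H → P H)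
    (sum : ∀ u (H H₂ : HilbertRep C) (j₁ : π u →L[ℂ] H) (j₂ : H₂ →L[ℂ] H), IsSum j₁ j₂ →
      FiniteDimensional ℂ (T.ind H₂) → P H₂ → P H)
    [FiniteDimensional ℂ (T.ind H)] (h : Gen T π H) : P H := by
  induction hn : Module.finrank ℂ (T.ind H) using Nat.strong_induction_on generalizing H with
  | _ n ih =>
  -- If no member of the family maps nontrivially to `H`, generation leaves only null vectors.
  -- Otherwise a nonzero intertwiner is rescaled to an isometry and its image is split off.
  by_cases h0 : ∀ u, ∀ φ ∈ hom (π u) H, φ = 0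
  · refine null H fun x => ?_
    have hS := isSum_incl (T.nullVec H) isClosed_nullVec act_mem_nullVec
    rw [← hS.add_eq x]
    refine add_mem (incl_mem _ _ _ _) ?_
    have h' : ∀ z, H.incl (T.nullVec H)ᗮ (Submodule.isClosed_orthogonal _)
        (act_mem_orthogonal _ act_mem_nullVec) z = 0 := fun z => by
      refine h _ (fun u φ hφ y => ?_) fun y hy => ?_
      · rw [h0 u φ hφ, zero_apply, inner_zero_left]
      · exact (Submodule.mem_orthogonal (T.nullVec H) _).1 (incl_mem _ _ _ _) _ hy
    rw [h']
    exact zero_mem _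
  · push Not at h0
    obtain ⟨u, φ, hφ, hφ0⟩ := h0
    have := hfin u
    obtain ⟨s, -, hj⟩ := (hirr u).exists_isEmb (hπT u) hφ hφ0
    obtain ⟨H₂, j₂, hS⟩ := hj.exists_isSum
    have := finiteDimensional_ind_of_isEmb (T := T) hS.right
    have h₁ := finrank_ind_eq (T := T) hS
    have h₂ := finrank_ind_pos (hπT u)
    exact sum u H H₂ _ j₂ hS this (ih _ (by omega) (h.of_isEmb hS.right) rfl)

/-- Irreducible subrepresentations that are not null are split off until the rest is null.
Equivalent members may occur in the family. -/
lemma exists_finite_gen (T : Correspondence D C) (H : HilbertRep C)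
    [FiniteDimensional ℂ (T.ind H)] :
    ∃ (U : Type u) (_ : Finite U) (π : U → HilbertRep C),
      (∀ u, Irreducible (π u) ∧ ¬ T.Null (π u) ∧ ∃ j : π u →L[ℂ] H, IsEmb j) ∧ Gen T π H := by
  induction hn : Module.finrank ℂ (T.ind H) using Nat.strong_induction_on generalizing H with
  | _ n ih =>
  by_cases hT : T.Null H
  · exact ⟨PEmpty, inferInstance, PEmpty.elim, fun u => u.elim, gen_of_null hT⟩
  obtain ⟨L, j, hj, hL, hLT⟩ := exists_irreducible_isEmb hT
  obtain ⟨H₂, j₂, hS⟩ := hj.exists_isSum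
  have := finiteDimensional_ind_of_isEmb (T := T) hS.left
  have := finiteDimensional_ind_of_isEmb (T := T) hS.right
  have h₁ := finrank_ind_eq (T := T) hS
  have h₂ := finrank_ind_pos hLT
  obtain ⟨U, _, π, hπ, hg⟩ := ih _ (by omega) H₂ rfl
  refine ⟨Option U, inferInstance, fun o => o.elim L π, fun o => ?_, ?_⟩
  · cases o with
    | none => exact ⟨hL, hLT, j, hj⟩
    | some u =>
      obtain ⟨h₁, h₂, j', hj'⟩ := hπ u
      exact ⟨h₁, h₂, _, hS.right.comp hj'⟩
  · refine Gen.of_isSum hS ?_ (hg.mono fun u => ⟨some u, Iso.refl _⟩)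
    exact gen_self (π := fun o : Option U => o.elim L π) none

end Gen

end HilbertRep

/-! ### Generation and multiplicities under induction -/

namespace HilbertRep

open Correspondence ContinuousLinearMap

section

variable {C C' D D' : Type u} [NonUnitalCStarAlgebra C] [NonUnitalCStarAlgebra C']
  [NonUnitalCStarAlgebra D] [NonUnitalCStarAlgebra D'] {T : Correspondence D C}
  {T' : Correspondence D' C'} {F : Correspondence C' C} {U U' : Type*} {π : U → HilbertRep C}
  {π' : U' → HilbertRep C'} {H : HilbertRep C} {L : HilbertRep C'}

/-- If `z` is orthogonal to the generators of `F.ind H`, the adjoint of `x ↦ r ⊗ x` sends `z` to a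
vector orthogonal to the generators of `H`. No finiteness of `H` is involved, which lets the lemma
apply to iterated inductions of arbitrary representations. -/
lemma Gen.ind (h : Gen T π H) (hirr : ∀ u, Irreducible (π u)) (hπT : ∀ u, ¬ T.Null (π u))
    (hfin : ∀ u, FiniteDimensional ℂ (T.ind (π u)))
    (hF₀ : ∀ K, T.Null K → T'.Null (F.ind K)) (hF : ∀ u, Gen T' π' (F.ind (π u))) :
    Gen T' π' (F.ind H) := by
  intro z h₁ h₂
  refine eq_zero_of_inner_tm fun r x => ?_
  rw [← tmL_apply, ← adjoint_inner_right]
  have : adjoint (F.tmL H r) z = 0 := by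
    refine h _ (fun u φ hφ y => ?_) fun y hy => ?_
    · by_cases hφ0 : φ = 0
      · rw [hφ0, zero_apply, inner_zero_left]
      have := hfin u
      obtain ⟨s, hs, hj⟩ := (hirr u).exists_isEmb (hπT u) hφ hφ0
      obtain ⟨J, hJ, hJf⟩ := F.exists_ind_map hj
      have h0 : adjoint J z = 0 := hF u _ (fun u' ψ hψ y => by
        rw [adjoint_inner_right]
        exact h₁ u' _ (comp_mem_hom hJ.mem hψ) y) fun y hy => by
          rw [adjoint_inner_right]
          exact h₂ _ (map_mem_nullVec hJ.mem hy)
      -- The map `J` is induced by the isometry `s • φ`; the factor `s⁻¹` undoes the rescaling.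
      have h₃ : ⟪J (F.tm (π u) r (s⁻¹ • y)), z⟫_ℂ = 0 := by
        rw [← adjoint_inner_right, h0, inner_zero_right]
      rwa [hJf, map_smul, smul_apply, inv_smul_smul₀ hs, ← tmL_apply, ← adjoint_inner_right] at h₃
    · rw [adjoint_inner_right]
      obtain ⟨J, hJ, hJf⟩ := F.exists_ind_map
        (isEmb_incl (T.nullVec H) isClosed_nullVec act_mem_nullVec)
      obtain ⟨y, rfl⟩ := exists_incl (T.nullVec H) isClosed_nullVec act_mem_nullVec hy
      rw [tmL_apply, ← hJf]
      refine h₂ _ (map_mem_nullVec hJ.mem (hF₀ _ (fun x => ?_) _))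
      exact mem_nullVec_of_map (isEmb_incl _ _ _) (incl_mem _ _ _ x)
  rw [this, inner_zero_right]

/-- Both sides are additive when a `π u` is split off, and both vanish on null representations.
Finite dimensionality of `T'.ind (F.ind H)` is carried through the induction because additivity of
multiplicities depends on it. -/
lemma Gen.mult_ind [Fintype U] (hirr : ∀ u, Irreducible (π u)) (hπT : ∀ u, ¬ T.Null (π u))
    (hfin : ∀ u, FiniteDimensional ℂ (T.ind (π u))) (hinj : ∀ u v, Iso (π u) (π v) → u = v)
    (hF₀ : ∀ K, T.Null K → T'.Null (F.ind K))
    (hF : ∀ u, FiniteDimensional ℂ (T'.ind (F.ind (π u))))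
    [FiniteDimensional ℂ (T.ind H)] (h : Gen T π H) :
    FiniteDimensional ℂ (T'.ind (F.ind H)) ∧ ∀ L, Irreducible L → ¬ T'.Null L →
      mult L (F.ind H) = ∑ u, mult L (F.ind (π u)) * mult (π u) H := by
  refine Gen.induction (P := fun H => FiniteDimensional ℂ (T'.ind (F.ind H)) ∧
    ∀ L, Irreducible L → ¬ T'.Null L →
      mult L (F.ind H) = ∑ u, mult L (F.ind (π u)) * mult (π u) H) hirr hπT hfin (fun H hH => ?_) 
    (fun u H H₂ j₁ j₂ hS hfin₂ ih => ?_) h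
  · have := null_iff_ind.1 (hF₀ H hH)
    have : Subsingleton (T'.ind (F.ind H)) := subsingleton_of_forall_eq 0 this
    refine ⟨inferInstance, fun L hL hLT => ?_⟩
    rw [hL.mult_eq_zero_of_null hLT (hF₀ H hH)]
    refine (Finset.sum_eq_zero fun u _ => ?_).symm
    rw [(hirr u).mult_eq_zero_of_null (hπT u) hH, mul_zero]
  · obtain ⟨hfin', ih⟩ := ih
    obtain ⟨J₁, J₂, hJ⟩ := F.ind_isSum hS
    obtain ⟨J₁', J₂', hJ'⟩ := T'.ind_isSum hJ
    have := hF u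
    refine ⟨hJ'.equivProd.symm.finiteDimensional, fun L hL hLT => ?_⟩
    have := hL.finiteDimensional_hom hLT (H := F.ind (π u))
    have := hL.finiteDimensional_hom hLT (H := F.ind H₂)
    classical
    rw [hJ.mult_eq L, ih L hL hLT]
    -- Schur's lemma and the pairwise inequivalence of the family make the multiplicities in `π u` a
    -- Kronecker delta.
    have hm : ∀ v, mult (π v) H = (if v = u then 1 else 0) + mult (π v) H₂ := fun v => by
      have := hfin u
      have := hfin v
      have := (hirr v).finiteDimensional_hom (hπT v) (H := π u)
      have := (hirr v).finiteDimensional_hom (hπT v) (H := H₂)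
      rw [hS.mult_eq (π v)]
      congr 1
      split_ifs with hvu
      · rw [hvu]; exact (hirr u).mult_self (hπT u)
      · exact (hirr v).mult_eq_zero (hπT v) (hirr u) fun e => hvu (hinj _ _ e)
    simp only [hm, mul_add, Finset.sum_add_distrib]
    simp

end

/-- A representation on which the algebra acts by zero. -/
def ActZero {C : Type u} [NonUnitalCStarAlgebra C] (H : HilbertRep C) : Prop :=
  ∀ a x, H.act a x = 0

lemma ActZero.of_iso {C : Type u} [NonUnitalCStarAlgebra C] {H K : HilbertRep C} (h : ActZero K)
    (e : Iso H K) : ActZero H := fun a x => by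
  obtain ⟨φ, hφ, -⟩ := e
  exact hφ.injective (by rw [hφ.mem, h, map_zero])

lemma ActZero.null {C D : Type u} [NonUnitalCStarAlgebra C] [NonUnitalCStarAlgebra D]
    {H : HilbertRep C} (h : ActZero H) (T : Correspondence D C) : T.Null H := fun x _ _ => h _ x

lemma ActZero.ind {C D : Type u} [NonUnitalCStarAlgebra C] [NonUnitalCStarAlgebra D]
    {H : HilbertRep C} (h : ActZero H) (T : Correspondence D C) : ActZero (T.ind H) := fun a x => by
  rw [null_iff_ind.1 (h.null T) x, map_zero]

end HilbertRep

/-! ### Models and their transfer along an elementary relation -/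

namespace Correspondence

open HilbertRep

variable {C C' D : Type u} [NonUnitalCStarAlgebra C] [NonUnitalCStarAlgebra C']
  [NonUnitalCStarAlgebra D]

/-- Iterated induction. -/
def iterInd (Z : Correspondence C C) : ℕ → HilbertRep C → HilbertRep C
  | 0, H => H
  | k + 1, H => Z.ind (Z.iterInd k H)

/-- Regrouping `(S R)^(k + 1) = S (R S)^k R`. -/
lemma iterInd_succ_iso {Z : Correspondence C C} {Z' : Correspondence C' C'}
    {R : Correspondence C C'} {S : Correspondence C' C}
    (e : ∀ H, Iso (Z.ind H) (R.ind (S.ind H))) (e' : ∀ H, Iso (Z'.ind H) (S.ind (R.ind H)))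
    (k : ℕ) (H : HilbertRep C') :
    Iso (Z'.iterInd (k + 1) H) (S.ind (Z.iterInd k (R.ind H))) := by
  induction k with
  | zero => exact e' H
  | succ k ih =>
    exact (Z'.ind_iso ih).trans ((e' _).trans (S.ind_iso (e _).symm))

/-- The irreducible representations `π u`, none of which is annihilated by `T`, span a part of the
representation theory of `C` on which induction by `Z` is described by the matrix `M`, up to
representations annihilated by `T`, and in which every representation ends up after sufficiently
many inductions. -/
structure IsModel (T : Correspondence D C) (Z : Correspondence C C) {U : Type u}
    (π : U → HilbertRep C) (M : Matrix U U ℕ) : Prop where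
  irreducible : ∀ u, (π u).Irreducible
  not_null : ∀ u, ¬ T.Null (π u)
  injective : ∀ u v, Iso (π u) (π v) → u = v
  null_ind : ∀ K, T.Null K → T.Null (Z.ind K)
  -- Which representations are null depends on `T`, which changes along the chain. This property and
  -- `gen_iterInd` compare with the full representation theory; each elementary relation raises
  -- their exponents by one.
  null_iterInd : ∃ k, ∀ K, T.Null K → ActZero (Z.iterInd k K)
  finiteDimensional : ∀ u, FiniteDimensional ℂ (T.ind (π u))
  finiteDimensional_ind : ∀ u, FiniteDimensional ℂ (T.ind (Z.ind (π u)))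
  gen : ∀ u, Gen T π (Z.ind (π u))
  gen_iterInd : ∃ k, ∀ H, Gen T π (Z.iterInd k H)
  mult_eq : ∀ u v, mult (π u) (Z.ind (π v)) = M u v

/-- The new measuring correspondence is `T ⊗ R`, and the new family consists of the irreducibles
split off from the `S.ind (π u)`, one from each equivalence class. Counting multiplicities in `R.ind
(S.ind (π u))` and `S.ind (R.ind (π' q))` gives the two matrix products. -/
lemma IsModel.exists_of_elementaryStrongShiftRelated {T : Correspondence D C}
    {Z : Correspondence C C} {U : Type u} [Fintype U] {π : U → HilbertRep C} {M : Matrix U U ℕ}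
    (h : IsModel T Z π M) {Z' : Correspondence C' C'} (hZ : ElementaryStrongShiftRelated Z Z') :
    ∃ (T' : Correspondence D C') (U' : Type u) (_ : Fintype U') (π' : U' → HilbertRep C')
      (M' : Matrix U' U' ℕ), ElementaryShiftRelated M M' ∧ IsModel T' Z' π' M' := by
  obtain ⟨R, S, hX, hY⟩ := hZ
  have e : ∀ H, Iso (Z.ind H) (R.ind (S.ind H)) := hX.ind_tensor_iso
  have e' : ∀ H, Iso (Z'.ind H) (S.ind (R.ind H)) := fun H =>
    (hY.ind_iso H).symm.trans (ind_tensor_iso S R H)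
  let T' := T.tensor R
  have eT : ∀ H, Iso (T'.ind H) (T.ind (R.ind H)) := ind_tensor_iso T R
  have hR₀ : ∀ K, T'.Null K → T.Null (R.ind K) := fun K => null_tensor.1
  have hS₀ : ∀ K, T.Null K → T'.Null (S.ind K) := fun K hK =>
    null_tensor.2 ((h.null_ind K hK).of_iso (e K).symm)
  -- Inducing `S.ind (π u)` by `T ⊗ R` amounts to inducing `Z.ind (π u)` by `T`.
  have hSfin : ∀ u, FiniteDimensional ℂ (T'.ind (S.ind (π u))) := fun u =>
    have := h.finiteDimensional_ind u
    ((T.ind_iso (e (π u))).trans (eT _).symm).finiteDimensional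
  choose I hI ρ hρ hρgen using fun u => exists_finite_gen T' (S.ind (π u))
  let σ : (Σ u, I u) → HilbertRep C' := fun i => ρ i.1 i.2
  -- The finitely many irreducibles found for the various `u` are identified when equivalent.
  let s : Setoid (Σ u, I u) :=
    { r := fun i j => Iso (σ i) (σ j)
      iseqv := ⟨fun _ => Iso.refl _, Iso.symm, Iso.trans⟩ }
  let U' := Quotient s
  let π' : U' → HilbertRep C' := fun q => σ q.out
  let _ : Fintype U' := Fintype.ofFinite U'
  have hirr' : ∀ q, (π' q).Irreducible := fun q => (hρ _ _).1
  have hnull' : ∀ q, ¬ T'.Null (π' q) := fun q => (hρ _ _).2.1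
  have hinj' : ∀ q q', Iso (π' q) (π' q') → q = q' := fun q q' hq => by
    rw [← Quotient.out_eq q, ← Quotient.out_eq q']
    exact Quotient.sound hq
  have hemb : ∀ q, ∃ u, ∃ j : π' q →L[ℂ] S.ind (π u), IsEmb j := fun q => ⟨_, (hρ _ _).2.2⟩
  have hgenS : ∀ u, Gen T' π' (S.ind (π u)) := fun u => (hρgen u).mono fun i =>
    ⟨Quotient.mk s ⟨u, i⟩, Quotient.exact (Quotient.out_eq (Quotient.mk s ⟨u, i⟩)).symm⟩
  have hfin' : ∀ q, FiniteDimensional ℂ (T'.ind (π' q)) := fun q => by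
    obtain ⟨u, j, hj⟩ := hemb q
    have := hSfin u
    exact finiteDimensional_ind_of_isEmb hj
  have hRfin : ∀ q, FiniteDimensional ℂ (T.ind (R.ind (π' q))) := fun q =>
    have := hfin' q
    (eT (π' q)).finiteDimensional
  -- As `π' q` embeds in some `S.ind (π u)`, the representation `R.ind (π' q)` embeds in one
  -- equivalent to `Z.ind (π u)`, which is generated by `π`.
  have hgenR : ∀ q, Gen T π (R.ind (π' q)) := fun q => by
    obtain ⟨u, j, hj⟩ := hemb q
    obtain ⟨J, hJ, -⟩ := R.exists_ind_map hj
    exact ((h.gen u).of_iso (e (π u)).symm).of_isEmb hJ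
  have hSR : ∀ q, FiniteDimensional ℂ (T'.ind (S.ind (R.ind (π' q)))) ∧
      ∀ L, L.Irreducible → ¬ T'.Null L →
      mult L (S.ind (R.ind (π' q))) = ∑ u, mult L (S.ind (π u)) * mult (π u) (R.ind (π' q)) :=
    fun q => have := hRfin q
      Gen.mult_ind h.irreducible h.not_null h.finiteDimensional h.injective hS₀ hSfin (hgenR q)
  let Rm : Matrix U U' ℕ := fun u q => mult (π u) (R.ind (π' q))
  let Sm : Matrix U' U ℕ := fun q u => mult (π' q) (S.ind (π u))
  refine ⟨T', U', inferInstance, π', Sm * Rm, ⟨Rm, Sm, ?_, rfl⟩, hirr', hnull', hinj', ?_, ?_,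
    hfin', ?_, ?_, ?_, ?_⟩
  · ext u v
    have := hSfin v
    rw [← h.mult_eq, (e (π v)).mult_eq]
    exact (Gen.mult_ind hirr' hnull' hfin' hinj' hR₀ hRfin (hgenS v)).2 _ (h.irreducible u)
      (h.not_null u)
  · exact fun K hK => (hS₀ _ (hR₀ K hK)).of_iso (e' K)
  · obtain ⟨k, hk⟩ := h.null_iterInd
    exact ⟨k + 1, fun K hK => ((hk _ (hR₀ K hK)).ind S).of_iso (iterInd_succ_iso e e' k K)⟩
  · exact fun q => have := (hSR q).1
      (T'.ind_iso (e' (π' q)).symm).finiteDimensional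
  · exact fun q => Gen.of_iso ((hgenR q).ind h.irreducible h.not_null h.finiteDimensional hS₀
      hgenS) (e' (π' q))
  · obtain ⟨k, hk⟩ := h.gen_iterInd
    exact ⟨k + 1, fun H => Gen.of_iso ((hk (R.ind H)).ind h.irreducible h.not_null
      h.finiteDimensional hS₀ hgenS) (iterInd_succ_iso e e' k H)⟩
  · intro q q'
    rw [(e' (π' q')).mult_eq]
    exact (hSR q').2 _ (hirr' q) (hnull' q)

end Correspondence

/-! ### Representations of finite dimensional commutative C*-algebras -/

namespace HilbertRep

open Correspondence ContinuousLinearMap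

variable {V W : Type u} [Fintype V] [Fintype W]

/-- The one-dimensional representation of `V → ℂ` by evaluation at `v`. -/
def delta (v : V) : HilbertRep (V → ℂ) where
  carrier := EuclideanSpace ℂ PUnit.{u + 1}
  act :=
    { toFun := fun a => a v • ContinuousLinearMap.id ℂ _
      map_smul' := fun c a => by ext x; simp [mul_assoc]
      map_zero' := by ext x; simp
      map_add' := fun a b => by ext x; simp [add_mul]
      map_mul' := fun a b => by ext x; simp [mul_assoc, mul_left_comm]
      map_star' := fun a => by
        rw [ContinuousLinearMap.star_eq_adjoint, ContinuousLinearMap.eq_adjoint_iff]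
        intro x y
        simp [inner_smul_left, inner_smul_right] }

instance (v : V) : FiniteDimensional ℂ (delta v).carrier :=
  inferInstanceAs (FiniteDimensional ℂ (EuclideanSpace ℂ PUnit.{u + 1}))

lemma delta_act (v : V) (a : V → ℂ) (x : delta v) : (delta v).act a x = a v • x := rfl

/-- The unit vector of the representation `delta v`. -/
def deltaOne (v : V) : delta v := EuclideanSpace.single (𝕜 := ℂ) PUnit.unit 1

lemma inner_deltaOne (v : V) : ⟪deltaOne v, deltaOne v⟫_ℂ = 1 := by
  change ⟪EuclideanSpace.single (𝕜 := ℂ) PUnit.unit 1, EuclideanSpace.single PUnit.unit 1⟫_ℂ = 1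
  simp

lemma deltaOne_ne_zero (v : V) : deltaOne v ≠ 0 := fun h => by
  have := inner_deltaOne v
  rw [h, inner_zero_left] at this
  exact zero_ne_one this

lemma eq_smul_deltaOne {v : V} (x : delta v) : x = ⟪deltaOne v, x⟫_ℂ • deltaOne v := by
  change EuclideanSpace ℂ PUnit.{u + 1} at x
  change x = ⟪EuclideanSpace.single (𝕜 := ℂ) PUnit.unit 1, x⟫_ℂ •
    EuclideanSpace.single (𝕜 := ℂ) PUnit.unit 1
  ext i
  simp [EuclideanSpace.inner_single_left]

/-- The intertwiner from `delta v` given by an eigenvector. -/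
def deltaMap (v : V) {L : HilbertRep (V → ℂ)} (z : L) : delta v →L[ℂ] L :=
  (innerSL ℂ (deltaOne v)).smulRight z

lemma deltaMap_apply (v : V) {L : HilbertRep (V → ℂ)} (z : L) (x : delta v) :
    deltaMap v z x = ⟪deltaOne v, x⟫_ℂ • z := rfl

lemma deltaMap_deltaOne (v : V) {L : HilbertRep (V → ℂ)} (z : L) :
    deltaMap v z (deltaOne v) = z := by
  rw [deltaMap_apply, inner_deltaOne, one_smul]

lemma deltaMap_mem_hom {v : V} {L : HilbertRep (V → ℂ)} {z : L}
    (hz : ∀ a : V → ℂ, L.act a z = a v • z) : deltaMap v z ∈ hom (delta v) L := fun a x => by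
  rw [deltaMap_apply, deltaMap_apply, map_smul, hz, delta_act, inner_smul_right, smul_smul, mul_comm]

lemma irreducible_delta (v : V) : Irreducible (delta v) := fun K _ _ => by
  refine or_iff_not_imp_left.2 fun hK => ?_
  obtain ⟨x, hx, hx0⟩ := (Submodule.ne_bot_iff K).1 hK
  rw [eq_smul_deltaOne x] at hx hx0
  have h := (K.smul_mem_iff (left_ne_zero_of_smul hx0)).1 hx
  refine eq_top_iff.2 fun y _ => ?_
  rw [eq_smul_deltaOne y]
  exact K.smul_mem _ h

section

variable [DecidableEq V]

lemma act_eq_sum (H : HilbertRep (V → ℂ)) (a : V → ℂ) (x : H) :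
    H.act a x = ∑ v, a v • H.act (Pi.single v 1) x := by
  conv_lhs => rw [pi_eq_sum_univ' a]
  rw [map_sum, sum_apply]
  refine Finset.sum_congr rfl fun v _ => ?_
  rw [map_smul, smul_apply]

lemma act_act_single (H : HilbertRep (V → ℂ)) (a : V → ℂ) (v : V) (x : H) :
    H.act a (H.act (Pi.single v 1) x) = a v • H.act (Pi.single v 1) x := by
  rw [← act_mul, ← smul_apply, ← map_smul]
  congr 2
  ext w
  by_cases h : w = v
  · subst h; simp
  · simp [h]

lemma inner_act_single (H : HilbertRep (V → ℂ)) (v : V) (x y : H) :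
    ⟪H.act (Pi.single v 1) x, y⟫_ℂ = ⟪x, H.act (Pi.single v 1) y⟫_ℂ := by
  rw [inner_act_left]
  congr 3
  ext w
  by_cases h : w = v
  · subst h; simp
  · simp [h]

end

/-- Every representation of `V → ℂ` is generated by the representations `delta v` and by the
vectors on which the algebra acts by zero. -/
lemma gen_delta {D : Type u} [NonUnitalCStarAlgebra D] (T : Correspondence D (V → ℂ))
    (H : HilbertRep (V → ℂ)) : Gen T delta H := fun h h₁ h₂ => by
  classical
  have hv : ∀ v, H.act (Pi.single v 1) h = 0 := fun v => by
    have := h₁ v _ (deltaMap_mem_hom fun a => act_act_single H a v h) (deltaOne v)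
    rw [deltaMap_deltaOne] at this
    rw [← inner_self_eq_zero (𝕜 := ℂ), inner_act_single, act_act_single, Pi.single_eq_same, one_smul,
      ← inner_act_single, this]
  refine inner_self_eq_zero.1 (h₂ h fun t t' => ?_)
  rw [act_eq_sum]
  exact Finset.sum_eq_zero fun v _ => by rw [hv, smul_zero]

/-- An irreducible representation of `V → ℂ` with nonzero action is of the form `delta v`. -/
lemma Irreducible.exists_iso_delta {H : HilbertRep (V → ℂ)} (hH : Irreducible H)
    (h0 : ¬ ActZero H) : ∃ v, Iso (delta v) H := by
  classical
  unfold ActZero at h0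
  push Not at h0
  obtain ⟨a, x, hax⟩ := h0
  rw [act_eq_sum] at hax
  obtain ⟨v, -, hv⟩ := Finset.exists_ne_zero_of_sum_ne_zero hax
  -- A nonzero vector in the range of the projection at `v` is a joint eigenvector. Once normalized,
  -- it defines an isometric intertwiner from `delta v`, which is onto by irreducibility.
  set y := H.act (Pi.single v 1) x with hy
  have hy0 : y ≠ 0 := right_ne_zero_of_smul hv
  have hn : ‖y‖ ≠ 0 := norm_ne_zero_iff.2 hy0
  obtain ⟨z, hz, hzz⟩ : ∃ z : H, (∀ a : V → ℂ, H.act a z = a v • z) ∧ ⟪z, z⟫_ℂ = 1 := by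
    refine ⟨((‖y‖⁻¹ : ℝ) : ℂ) • y, fun a => ?_, ?_⟩
    · rw [map_smul, hy, act_act_single, smul_comm]
    · rw [inner_self_eq_norm_sq_to_K, norm_smul, Complex.norm_real, norm_inv, norm_norm,
        inv_mul_cancel₀ hn]
      simp
  have hj : IsEmb (deltaMap v z) := by
    refine ⟨deltaMap_mem_hom hz, fun p q => ?_⟩
    conv_rhs => rw [eq_smul_deltaOne p, eq_smul_deltaOne q]
    rw [deltaMap_apply, deltaMap_apply, inner_smul_left, inner_smul_right, inner_smul_left,
      inner_smul_right, hzz, inner_deltaOne]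
  exact ⟨v, _, hj, hH.surjective hj (deltaOne_ne_zero v)⟩

lemma eq_of_delta_iso {v : V} {H : HilbertRep (V → ℂ)} (h : Iso (delta v) H) {w : V}
    [DecidableEq V] {x : H} (hx : H.act (Pi.single w 1) x ≠ 0) : v = w := by
  obtain ⟨φ, hφ, hs⟩ := h
  obtain ⟨y, rfl⟩ := hs x
  by_contra hvw
  refine hx ?_
  rw [← hφ.mem, delta_act, Pi.single_eq_of_ne hvw, zero_smul, map_zero]

end HilbertRep

namespace Correspondence

open HilbertRep ContinuousLinearMap

/-- The image of the algebraic tensor product is dense and, being finite dimensional, closed. -/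
lemma finiteDimensional_ind {A B : Type u} [NonUnitalCStarAlgebra A] [NonUnitalCStarAlgebra B]
    (R : Correspondence A B) (H : HilbertRep B) [FiniteDimensional ℂ R.carrier]
    [FiniteDimensional ℂ H] : FiniteDimensional ℂ (R.ind H) := by
  let f : R.carrier ⊗[ℂ] H.carrier →ₗ[ℂ] (R.ind H).carrier :=
    (R.toSemi.tensor H.toSemi).toHilbert
  have hf : DenseRange f := (R.toSemi.tensor H.toSemi).denseRange_toHilbert
  have hc : IsClosed (LinearMap.range f : Set (R.ind H)) :=
    Submodule.closed_of_finiteDimensional (LinearMap.range f)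
  have hs : Function.Surjective f := by
    rw [← Set.range_eq_univ, ← hf.closure_range]
    exact hc.closure_eq.symm
  exact Module.Finite.of_surjective f hs

end Correspondence

/-! ### Induction by graph correspondences -/

section Graph

open HilbertRep Correspondence

variable {V W : Type u} [Fintype V] [Fintype W]

instance (R : Matrix V W ℕ) : FiniteDimensional ℂ (graphCorrespondence R).carrier :=
  inferInstanceAs (FiniteDimensional ℂ (Edge R → ℂ))

open Classical in
/-- The indicator function of an edge, in the correspondence of a matrix. -/
def edgeVec (R : Matrix V W ℕ) (e : Edge R) : (graphCorrespondence R).carrier :=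
  (Pi.single e 1 : Edge R → ℂ)

variable {R : Matrix V W ℕ}

open Classical in
lemma edgeVec_same (e : Edge R) : (show Edge R → ℂ from edgeVec R e) e = 1 :=
  Pi.single_eq_same _ _

open Classical in
lemma edgeVec_of_ne {e e' : Edge R} (h : e' ≠ e) :
    (show Edge R → ℂ from edgeVec R e) e' = 0 :=
  Pi.single_eq_of_ne h _

lemma lsmul_edgeVec (a : V → ℂ) (e : Edge R) :
    (graphCorrespondence R).toSemi.lsmul a (edgeVec R e) = a e.1 • edgeVec R e := by
  refine funext fun e' => ?_
  change a e'.1 * (show Edge R → ℂ from edgeVec R e) e'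
    = a e.1 * (show Edge R → ℂ from edgeVec R e) e'
  by_cases h : e' = e
  · rw [h]
  · rw [edgeVec_of_ne h, mul_zero, mul_zero]

lemma rsmul_edgeVec (b : W → ℂ) (e : Edge R) :
    (graphCorrespondence R).toSemi.rsmul b (edgeVec R e) = b e.2.1 • edgeVec R e := by
  refine funext fun e' => ?_
  change (show Edge R → ℂ from edgeVec R e) e' * b e'.2.1
    = b e.2.1 * (show Edge R → ℂ from edgeVec R e) e'
  by_cases h : e' = e
  · rw [h, mul_comm]
  · rw [edgeVec_of_ne h, mul_zero, zero_mul]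

lemma inner_edgeVec [DecidableEq W] (e : Edge R) (η : (graphCorrespondence R).carrier) :
    (graphCorrespondence R).toSemi.inner (edgeVec R e) η
      = Pi.single e.2.1 ((show Edge R → ℂ from η) e) := by
  obtain ⟨v, w, k⟩ := e
  ext w'
  change ∑ v', ∑ k' : Fin (R v' w'), starRingEnd ℂ
    ((show Edge R → ℂ from edgeVec R ⟨v, w, k⟩) ⟨v', w', k'⟩)
      * (show Edge R → ℂ from η) ⟨v', w', k'⟩ = _
  by_cases hw : w' = w
  · subst hw
    rw [Finset.sum_eq_single v, Finset.sum_eq_single k]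
    · rw [edgeVec_same, map_one, one_mul, Pi.single_eq_same]
    · intro k' _ hk
      rw [edgeVec_of_ne fun h => hk (by simpa using h), map_zero, zero_mul]
    · simp
    · intro v' _ hv
      refine Finset.sum_eq_zero fun k' _ => ?_
      rw [edgeVec_of_ne fun h => hv (congrArg Sigma.fst h), map_zero, zero_mul]
    · simp
  · rw [Pi.single_eq_of_ne hw]
    refine Finset.sum_eq_zero fun v' _ => Finset.sum_eq_zero fun k' _ => ?_
    rw [edgeVec_of_ne fun h => hw (congrArg (fun e : Edge R => e.2.1) h), map_zero, zero_mul]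

lemma inner_edgeVec_self [DecidableEq W] (e : Edge R) :
    (graphCorrespondence R).toSemi.inner (edgeVec R e) (edgeVec R e) = Pi.single e.2.1 1 := by
  rw [inner_edgeVec, edgeVec_same]

lemma inner_edgeVec_of_ne {e e' : Edge R} (h : e ≠ e') :
    (graphCorrespondence R).toSemi.inner (edgeVec R e) (edgeVec R e') = 0 := by
  classical
  rw [inner_edgeVec, edgeVec_of_ne h, Pi.single_zero]

lemma eq_sum_edgeVec (ξ : (graphCorrespondence R).carrier) :
    ξ = ∑ e, (show Edge R → ℂ from ξ) e • edgeVec R e := by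
  classical
  exact pi_eq_sum_univ' (show Edge R → ℂ from ξ)

lemma eq_zero_of_inner_tm_edgeVec {H : HilbertRep (W → ℂ)} {z : (graphCorrespondence R).ind H}
    (h : ∀ e x, ⟪(graphCorrespondence R).tm H (edgeVec R e) x, z⟫_ℂ = 0) : z = 0 := by
  refine eq_zero_of_inner_tm fun ξ x => ?_
  rw [eq_sum_edgeVec ξ, map_sum, LinearMap.sum_apply, sum_inner]
  refine Finset.sum_eq_zero fun e _ => ?_
  rw [map_smul, LinearMap.smul_apply, inner_smul_left, h, mul_zero]

lemma act_tm_edgeVec {H : HilbertRep (W → ℂ)} (a : V → ℂ) (e : Edge R) (x : H) :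
    ((graphCorrespondence R).ind H).act a ((graphCorrespondence R).tm H (edgeVec R e) x)
      = a e.1 • (graphCorrespondence R).tm H (edgeVec R e) x := by
  rw [act_tm, lsmul_edgeVec, map_smul, LinearMap.smul_apply]

/-- When every `w` receives an edge, each minimal projection at `w` is the inner product of an edge
vector with itself. -/
lemma actZero_of_null (hR : ∀ w, ∃ v, R v w ≠ 0) {H : HilbertRep (W → ℂ)}
    (h : (graphCorrespondence R).Null H) : ActZero H := fun a x => by
  classical
  rw [act_eq_sum]
  refine Finset.sum_eq_zero fun w _ => ?_
  obtain ⟨v, hv⟩ := hR w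
  let e : Edge R := ⟨v, w, ⟨0, Nat.pos_of_ne_zero hv⟩⟩
  have := h x (edgeVec R e) (edgeVec R e)
  rw [inner_edgeVec_self] at this
  rw [this, smul_zero]

/-- The unit of the algebra of functions acts as the identity on an induced representation, so a
zero action forces a zero space. -/
lemma null_of_actZero_ind {H : HilbertRep (W → ℂ)}
    (h : ActZero ((graphCorrespondence R).ind H)) : (graphCorrespondence R).Null H :=
  null_iff_ind.2 fun z => eq_zero_of_inner_tm_edgeVec fun e x => by
    have := h 1 ((graphCorrespondence R).tm H (edgeVec R e) x)
    rw [act_tm_edgeVec, Pi.one_apply, one_smul] at this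
    rw [this, inner_zero_left]

/-- An intertwiner from `delta v` is determined by the image of the unit vector, a joint eigenvector
for `v`. The tensors of the unit vector with the edges from `v` to `w` form an orthonormal basis of
these eigenvectors. -/
lemma mult_delta (v : V) (w : W) :
    mult (delta v) ((graphCorrespondence R).ind (delta w)) = R v w := by
  classical
  set X := graphCorrespondence R
  let f : Fin (R v w) → X.ind (delta w) := fun k => X.tm (delta w) (edgeVec R ⟨v, w, k⟩) (deltaOne w)
  have hf : Orthonormal ℂ f := by
    rw [orthonormal_iff_ite]
    intro k l
    change ⟪X.tm (delta w) _ _, X.tm (delta w) _ _⟫_ℂ = _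
    rw [inner_tm]
    split_ifs with hkl
    · subst hkl
      rw [inner_edgeVec_self, delta_act, Pi.single_eq_same, one_smul, inner_deltaOne]
    · rw [inner_edgeVec_of_ne (fun h => hkl (by simpa using h)), map_zero, zero_apply,
        inner_zero_right]
  have hact : ∀ (a : V → ℂ) k, (X.ind (delta w)).act a (f k) = a v • f k := fun a k =>
    act_tm_edgeVec a _ _
  let ev : hom (delta v) (X.ind (delta w)) →ₗ[ℂ] X.ind (delta w) :=
    { toFun := fun φ => φ.1 (deltaOne v)
      map_add' := fun _ _ => rfl
      map_smul' := fun _ _ => rfl }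
  have hev : Function.Injective ev := (injective_iff_map_eq_zero ev).2 fun φ hφ =>
    Subtype.ext ((irreducible_delta v).eq_zero φ.2 (deltaOne_ne_zero v) hφ)
  have hrange : LinearMap.range ev = Submodule.span ℂ (Set.range f) := by
    refine le_antisymm ?_ (Submodule.span_le.2 ?_)
    · rintro _ ⟨φ, rfl⟩
      set z := ev φ with hz
      have hzv : ∀ a : V → ℂ, (X.ind (delta w)).act a z = a v • z := fun a => by
        change (X.ind (delta w)).act a (φ.1 (deltaOne v)) = a v • φ.1 (deltaOne v)
        rw [← φ.2, delta_act, map_smul]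
      -- The part of `z` orthogonal to the span of `f` is tested against all edges: those from `v`
      -- to `w` belong to `f`, those to `w` from another source lie in another eigenspace, and those
      -- not ending in `w` give the zero tensor.
      have h0 : z - ∑ k, ⟪f k, z⟫_ℂ • f k = 0 := by
        refine eq_zero_of_inner_tm_edgeVec fun e x => ?_
        rw [eq_smul_deltaOne x, map_smul, inner_smul_left]
        refine mul_eq_zero_of_right _ ?_
        obtain ⟨v', w', k⟩ := e
        by_cases hw : w' = w
        · subst hw
          by_cases hv : v' = v
          · subst hv
            change ⟪f k, _⟫_ℂ = 0
            rw [inner_sub_right, hf.inner_right_fintype, sub_self]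
          · have hd : (X.ind (delta w')).act (Pi.single v 1) (z - ∑ k, ⟪f k, z⟫_ℂ • f k)
                = z - ∑ k, ⟪f k, z⟫_ℂ • f k := by
              simp only [map_sub, map_sum, map_smul, hzv, hact, Pi.single_eq_same, one_smul]
            rw [← hd, ← inner_act_single, act_tm_edgeVec, Pi.single_eq_of_ne hv, zero_smul,
              inner_zero_left]
        · have : X.tm (delta w) (edgeVec R ⟨v', w', k⟩) (deltaOne w) = 0 := by
            rw [← inner_self_eq_zero (𝕜 := ℂ), inner_tm, inner_edgeVec_self, delta_act,
              Pi.single_eq_of_ne (Ne.symm hw), zero_smul, inner_zero_right]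
          rw [this, inner_zero_left]
      rw [sub_eq_zero.1 h0]
      exact sum_mem fun k _ => Submodule.smul_mem _ _ (Submodule.subset_span ⟨k, rfl⟩)
    · rintro _ ⟨k, rfl⟩
      exact ⟨⟨deltaMap v (f k), deltaMap_mem_hom fun a => hact a k⟩, deltaMap_deltaOne v (f k)⟩
  rw [mult, ← LinearMap.finrank_range_of_inj hev, hrange,
    finrank_span_eq_card hf.linearIndependent, Fintype.card_fin]

lemma eq_of_delta_iso_delta {v w : V} (h : Iso (delta v) (delta w)) : v = w := by
  classical
  refine eq_of_delta_iso h (x := deltaOne w) ?_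
  rw [delta_act, Pi.single_eq_same, one_smul]
  exact deltaOne_ne_zero w

lemma not_actZero_delta (v : V) : ¬ ActZero (delta v) := fun h => by
  have := h 1 (deltaOne v)
  rw [delta_act, Pi.one_apply, one_smul] at this
  exact deltaOne_ne_zero v this

/-- The start of the chain, with the graph correspondence as its own measure. Null representations
already have zero action and the evaluations generate everything else, so both exponents are `0`. -/
lemma isModel_graphCorrespondence {A : Matrix V V ℕ} (hA : ∀ w, ∃ v, A v w ≠ 0) :
    IsModel (graphCorrespondence A) (graphCorrespondence A) delta A where
  irreducible := irreducible_delta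
  not_null v h := not_actZero_delta v (actZero_of_null hA h)
  injective _ _ := eq_of_delta_iso_delta
  null_ind _ hK := ((actZero_of_null hA hK).ind _).null _
  null_iterInd := ⟨0, fun _ hK => actZero_of_null hA hK⟩
  finiteDimensional _ := finiteDimensional_ind _ _
  finiteDimensional_ind v :=
    have := finiteDimensional_ind (graphCorrespondence A) (delta v)
    finiteDimensional_ind _ _
  gen _ := gen_delta _ _
  gen_iterInd := ⟨0, gen_delta _⟩
  mult_eq := mult_delta

/-! ### Identification of the model at the end of the chain -/

lemma actZero_of_iterInd {B : Matrix W W ℕ} (hB : ∀ w, ∃ v, B v w ≠ 0) {k : ℕ}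
    {H : HilbertRep (W → ℂ)} (h : ActZero ((graphCorrespondence B).iterInd k H)) : ActZero H := by
  induction k with
  | zero => exact h
  | succ k ih => exact ih (actZero_of_null hB (null_of_actZero_ind h))

/-- As no row is zero, a path of length `k` starts at `w`. The tensor product of its edges with the
unit vector at its last vertex is fixed by the projection at `w`. -/
lemma exists_act_single_iterInd_ne_zero {B : Matrix W W ℕ} (hB : ∀ w, ∃ w', B w w' ≠ 0)
    [DecidableEq W] (k : ℕ) (w : W) : ∃ (H : HilbertRep (W → ℂ))
      (x : (graphCorrespondence B).iterInd k H),
      ((graphCorrespondence B).iterInd k H).act (Pi.single w 1) x ≠ 0 := by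
  induction k generalizing w with
  | zero =>
    refine ⟨delta w, deltaOne w, ?_⟩
    change (delta w).act _ _ ≠ 0
    rw [delta_act, Pi.single_eq_same, one_smul]
    exact deltaOne_ne_zero w
  | succ k ih =>
    obtain ⟨w', hw'⟩ := hB w
    obtain ⟨H, x, hx⟩ := ih w'
    let e : Edge B := ⟨w, w', ⟨0, Nat.pos_of_ne_zero hw'⟩⟩
    refine ⟨H, (graphCorrespondence B).tm _ (edgeVec B e) x, fun h => hx ?_⟩
    change ((graphCorrespondence B).ind _).act _ _ = 0 at h
    rw [act_tm_edgeVec, Pi.single_eq_same, one_smul, ← inner_self_eq_zero (𝕜 := ℂ), inner_tm,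
      inner_edgeVec_self] at h
    rw [← inner_self_eq_zero (𝕜 := ℂ), inner_act_single, act_act_single, Pi.single_eq_same,
      one_smul]
    exact h

/-- The members of the family are irreducible with nonzero action, hence evaluations at points `f
u`, and distinct by inequivalence. If `w` were missed, the projection at `w` would act by zero on
every representation generated by the family, but it acts nontrivially on some iterated induction.
-/
lemma Correspondence.IsModel.exists_equiv {D : Type u} [NonUnitalCStarAlgebra D]
    {T : Correspondence D (W → ℂ)} {B : Matrix W W ℕ} (hB : IsEssential B) {U : Type u}
    {π : U → HilbertRep (W → ℂ)} {M : Matrix U U ℕ}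
    (h : IsModel T (graphCorrespondence B) π M) :
    ∃ e : U ≃ W, ∀ u v, M u v = B (e u) (e v) := by
  classical
  -- Null representations acquire zero action after `k` inductions. Induction by `B` keeps a nonzero
  -- action nonzero, since no column is zero, so the action was zero from the start.
  have hnull : ∀ K, T.Null K → ActZero K := fun K hK => by
    obtain ⟨k, hk⟩ := h.null_iterInd
    exact actZero_of_iterInd hB.2 (hk K hK)
  choose f hf using fun u => (h.irreducible u).exists_iso_delta fun h0 => h.not_null u (h0.null T)
  have hinj : Function.Injective f := fun u v huv =>
    h.injective u v ((hf u).symm.trans (huv ▸ hf v))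
  have hsurj : Function.Surjective f := fun w => by
    by_contra! hw
    obtain ⟨k, hk⟩ := h.gen_iterInd
    obtain ⟨H, x, hx⟩ := exists_act_single_iterInd_ne_zero hB.1 k w
    refine hx (hk H _ (fun u φ hφ y => ?_) fun y hy => ?_)
    · rw [← inner_act_single, ← hφ]
      have : (π u).act (Pi.single w 1) y = 0 := by
        by_contra hy
        exact hw u (eq_of_delta_iso (hf u) hy)
      rw [this, map_zero, inner_zero_left]
    · rw [← inner_act_single]
      obtain ⟨y, rfl⟩ := exists_incl (T.nullVec _) isClosed_nullVec act_mem_nullVec hy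
      have hj := isEmb_incl (T.nullVec ((graphCorrespondence B).iterInd k H)) isClosed_nullVec
        act_mem_nullVec
      rw [← hj.mem, hnull _ (fun x => mem_nullVec_of_map hj (incl_mem _ _ _ x)), map_zero,
        inner_zero_left]
  refine ⟨Equiv.ofBijective f ⟨hinj, hsurj⟩, fun u v => ?_⟩
  rw [← h.mult_eq, ← (hf u).mult_eq_left, ← ((graphCorrespondence B).ind_iso (hf v)).mult_eq]
  exact mult_delta _ _

lemma ElementaryShiftRelated.reindex {U U' : Type u} [Fintype U] [Fintype U'] {M : Matrix U U ℕ}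
    {M' : Matrix U' U' ℕ} {B : Matrix W W ℕ} (h : ElementaryShiftRelated M M') (e : U' ≃ W)
    (he : ∀ u v, M' u v = B (e u) (e v)) : ElementaryShiftRelated M B := by
  obtain ⟨R, S, rfl, rfl⟩ := h
  refine ⟨R.submatrix id e.symm, S.submatrix e.symm id, ?_, ?_⟩
  · rw [Matrix.submatrix_mul_equiv, Matrix.submatrix_id_id]
  · ext w w'
    have := he (e.symm w) (e.symm w')
    rw [e.apply_symm_apply, e.apply_symm_apply] at this
    rw [← this]
    rfl

/-- The statement concerns an arbitrary model, so that the first relation of the chain can be peeled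
off; after the last one, the model is matched with `B`. -/
lemma Correspondence.IsModel.matrixStrongShiftEquivalent {B : Matrix W W ℕ} (hB : IsEssential B)
    {D : Type u} [NonUnitalCStarAlgebra D] (m : ℕ) :
    ∀ {C : Type u} [NonUnitalCStarAlgebra C] {T : Correspondence D C} {Z : Correspondence C C}
      {U : Type u} [Fintype U] {π : U → HilbertRep C} {M : Matrix U U ℕ}, IsModel T Z π M →
      StrongShiftEquivalent m Z (graphCorrespondence B) → MatrixStrongShiftEquivalent m M B := by
  induction m with
  | zero => intro C _ T Z U _ π M _ h; exact h
  | succ m ih =>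
    intro C _ T Z U _ π M hM h
    cases m with
    | zero =>
      obtain ⟨T', U', _, π', M', hMM', hM'⟩ := hM.exists_of_elementaryStrongShiftRelated h
      obtain ⟨e, he⟩ := hM'.exists_equiv hB
      exact hMM'.reindex e he
    | succ m =>
      obtain ⟨C', _, Z', hZ, hZ'⟩ := h
      obtain ⟨T', U', _, π', M', hMM', hM'⟩ := hM.exists_of_elementaryStrongShiftRelated hZ
      exact ⟨U', inferInstance, M', hMM', ih hM' hZ'⟩

end Graph

/-! ### The correspondence of a product of matrices -/

lemma Correspondence.eq_zero_of_inner_self {A B : Type u} [NonUnitalCStarAlgebra A]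
    [NonUnitalCStarAlgebra B] {X : Correspondence A B} {x : X.carrier}
    (h : X.toSemi.inner x x = 0) : x = 0 := by
  have := X.norm_sq x
  rw [h, norm_zero] at this
  exact norm_eq_zero.1 ((pow_eq_zero_iff two_ne_zero).1 this)

lemma Correspondence.Isomorphic.symm {A B : Type u} [NonUnitalCStarAlgebra A]
    [NonUnitalCStarAlgebra B] {X Y : Correspondence A B} (h : X.Isomorphic Y) :
    Y.Isomorphic X := by
  obtain ⟨τ, hs, hl, hr, hi⟩ := h
  have hinj : Function.Injective τ := (injective_iff_map_eq_zero τ).2 fun x hx =>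
    eq_zero_of_inner_self (by rw [← hi, hx, map_zero])
  let e := LinearEquiv.ofBijective τ ⟨hinj, hs⟩
  have he : ∀ x, e x = τ x := fun _ => rfl
  refine ⟨e.symm.toLinearMap, e.symm.surjective, fun a y => ?_, fun b y => ?_, fun y z => ?_⟩
  · obtain ⟨x, rfl⟩ := e.surjective y
    simp only [LinearEquiv.coe_coe, e.symm_apply_apply]
    rw [e.symm_apply_eq, he, he, hl]
  · obtain ⟨x, rfl⟩ := e.surjective y
    simp only [LinearEquiv.coe_coe, e.symm_apply_apply]
    rw [e.symm_apply_eq, he, he, hr]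
  · obtain ⟨x, rfl⟩ := e.surjective y
    obtain ⟨x', rfl⟩ := e.surjective z
    simp only [LinearEquiv.coe_coe, e.symm_apply_apply]
    rw [he, he, hi]

/-- Edges of a product of matrices are paths of length two. -/
lemma exists_edge_mul_factorization {U V W : Type u} [Fintype V] (R : Matrix U V ℕ)
    (S : Matrix V W ℕ) :
    ∃ (l : Edge (R * S) → Edge R) (r : Edge (R * S) → Edge S),
      (∀ e, (l e).1 = e.1) ∧ (∀ e, (r e).2.1 = e.2.1) ∧ (∀ e, (l e).2.1 = (r e).1) ∧
      (∀ e e', l e = l e' → r e = r e' → e = e') ∧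
      ∀ a b, a.2.1 = b.1 → ∃ e, l e = a ∧ r e = b := by
  -- Any bijection will do; it exists because an entry of the product counts the paths of length
  -- two.
  have h : ∀ u w, Nonempty (Fin ((R * S) u w) ≃ Σ v, Fin (R u v) × Fin (S v w)) := fun u w =>
    Fintype.card_eq.1 (by rw [Fintype.card_fin, Matrix.mul_apply]; simp)
  let ε := fun u w => (h u w).some
  refine ⟨fun e => ⟨e.1, (ε _ _ e.2.2).1, (ε _ _ e.2.2).2.1⟩,
    fun e => ⟨(ε _ _ e.2.2).1, e.2.1, (ε _ _ e.2.2).2.2⟩, fun _ => rfl, fun _ => rfl, fun _ => rfl,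
    ?_, ?_⟩
  · rintro ⟨u, w, k⟩ ⟨u', w', k'⟩ h₁ h₂
    obtain rfl : u = u' := congrArg Sigma.fst h₁
    obtain rfl : w = w' := congrArg (fun e : Edge S => e.2.1) h₂
    have : ε u w k = ε u w k' := by
      revert h₁ h₂
      dsimp only
      generalize ε u w k = p
      generalize ε u w k' = p'
      obtain ⟨v, i, j⟩ := p
      obtain ⟨v', i', j'⟩ := p'
      intro h₁ h₂
      obtain rfl : v = v' := congrArg Sigma.fst h₂
      simp only [Sigma.mk.injEq, heq_eq_eq, true_and] at h₁ h₂
      rw [h₁, h₂]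
    rw [(ε u w).injective this]
  · rintro ⟨u, v, i⟩ ⟨v', w, j⟩ (rfl : v = v')
    have := (ε u w).apply_symm_apply ⟨v, i, j⟩
    exact ⟨⟨u, w, (ε u w).symm ⟨v, i, j⟩⟩,
      congrArg (fun p : Σ v, Fin (R u v) × Fin (S v w) => (⟨u, p.1, p.2.1⟩ : Edge R)) this,
      congrArg (fun p : Σ v, Fin (R u v) × Fin (S v w) => (⟨p.1, w, p.2.2⟩ : Edge S)) this⟩

variable {U V W : Type u} [Fintype U] [Fintype V] [Fintype W]

/-- The correspondence of a product of matrices is the interior tensor product. -/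
lemma graphCorrespondence_mul_isomorphic (R : Matrix U V ℕ) (S : Matrix V W ℕ) :
    (graphCorrespondence (R * S)).Isomorphic
      ((graphCorrespondence R).tensor (graphCorrespondence S)) := by
  classical
  obtain ⟨l, r, hl, hr, hlr, hinj, hsurj⟩ := exists_edge_mul_factorization R S
  set X := graphCorrespondence R
  set Y := graphCorrespondence S
  let P := X.toSemi.tensor Y.toSemi
  let ι : X.carrier ⊗[ℂ] Y.carrier →ₗ[ℂ] (X.tensor Y).carrier := P.toCompl
  let q : Edge R → Edge S → (X.tensor Y).carrier := fun a b =>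
    ι (edgeVec R a ⊗ₜ edgeVec S b)
  have hq : ∀ a b a' b', (X.tensor Y).toSemi.inner (q a b) (q a' b')
      = Y.toSemi.inner (edgeVec S b)
        (Y.toSemi.lsmul (X.toSemi.inner (edgeVec R a) (edgeVec R a')) (edgeVec S b')) :=
    fun a b a' b' => P.complInner_toCompl _ _
  have hql : ∀ c a b, (X.tensor Y).toSemi.lsmul c (q a b) = c a.1 • q a b := fun c a b => by
    refine (P.complLsmul_toCompl _ _).trans ?_
    change ι (X.toSemi.lsmul c (edgeVec R a) ⊗ₜ edgeVec S b) = _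
    rw [lsmul_edgeVec, ← TensorProduct.smul_tmul', map_smul]
  have hqr : ∀ c a b, (X.tensor Y).toSemi.rsmul c (q a b) = c b.2.1 • q a b := fun c a b => by
    refine (P.complRsmul_toCompl _ _).trans ?_
    change ι (edgeVec R a ⊗ₜ Y.toSemi.rsmul c (edgeVec S b)) = _
    rw [rsmul_edgeVec, TensorProduct.tmul_smul, map_smul]
  let τ : (graphCorrespondence (R * S)).carrier →ₗ[ℂ] (X.tensor Y).carrier :=
    Fintype.linearCombination ℂ (fun e : Edge (R * S) => q (l e) (r e))
  have hτ : ∀ e, τ (edgeVec (R * S) e) = q (l e) (r e) := fun e => by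
    refine (Finset.sum_eq_single e (fun e' _ he => ?_) (by simp)).trans ?_
    · exact (congrArg (· • q (l e') (r e')) (edgeVec_of_ne he)).trans (zero_smul _ _)
    · exact (congrArg (· • q (l e) (r e)) (edgeVec_same e)).trans (one_smul _ _)
  -- The tensors of composable pairs of edges have the Gram matrix of the edge vectors of the
  -- product.
  have hqq : ∀ e e', (X.tensor Y).toSemi.inner (q (l e) (r e)) (q (l e') (r e'))
      = (graphCorrespondence (R * S)).toSemi.inner (edgeVec _ e) (edgeVec _ e') := fun e e' => by
    rw [hq]
    by_cases h : l e = l e'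
    · rw [h, inner_edgeVec_self, lsmul_edgeVec, hlr, Pi.single_eq_same, one_smul]
      by_cases h' : r e = r e'
      · rw [hinj e e' h h', inner_edgeVec_self, inner_edgeVec_self, hr]
      · rw [inner_edgeVec_of_ne h', inner_edgeVec_of_ne fun he => h' (by rw [he])]
    · rw [inner_edgeVec_of_ne h, inner_edgeVec_of_ne fun he => h (by rw [he]), map_zero,
        LinearMap.zero_apply, map_zero]
  refine ⟨τ, ?_, fun a ξ => ?_, fun b ξ => ?_, fun ξ η => ?_⟩
  -- Tensors of edges that do not compose vanish, so the range contains the dense image of the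
  -- algebraic tensor product; it is closed, being finite dimensional.
  · have hmem : ∀ a b, q a b ∈ LinearMap.range τ := fun a b => by
      by_cases h : a.2.1 = b.1
      · obtain ⟨e, rfl, rfl⟩ := hsurj a b h
        exact ⟨_, hτ e⟩
      · have : q a b = 0 := Correspondence.eq_zero_of_inner_self (by
          rw [hq, inner_edgeVec_self, lsmul_edgeVec, Pi.single_eq_of_ne (Ne.symm h), zero_smul,
            map_zero])
        rw [this]
        exact zero_mem _
    have hmem' : ∀ z, ι z ∈ LinearMap.range τ := fun z => by
      induction z using TensorProduct.induction_on with
      | zero => rw [map_zero]; exact zero_mem _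
      | add z z' hz hz' => rw [map_add]; exact add_mem hz hz'
      | tmul ξ η =>
        rw [eq_sum_edgeVec ξ, eq_sum_edgeVec η]
        simp only [TensorProduct.sum_tmul, TensorProduct.tmul_sum, TensorProduct.tmul_smul,
          ← TensorProduct.smul_tmul', map_sum, map_smul]
        exact sum_mem fun b _ => Submodule.smul_mem _ _ (sum_mem fun a _ =>
          Submodule.smul_mem _ _ (hmem _ _))
    have hc : IsClosed (LinearMap.range τ : Set (X.tensor Y).carrier) :=
      Submodule.closed_of_finiteDimensional _
    exact fun z => P.compl_induction (p := fun z => ∃ ξ, τ ξ = z) z hc hmem'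
  · rw [eq_sum_edgeVec ξ]
    simp only [map_sum, map_smul, lsmul_edgeVec, hτ, hql, hl]
  · rw [eq_sum_edgeVec ξ]
    simp only [map_sum, map_smul, rsmul_edgeVec, hτ, hqr, hr]
  · rw [eq_sum_edgeVec ξ, eq_sum_edgeVec η]
    simp only [map_sum, map_smul, hτ, LinearMap.sum_apply,
      SemiCorrespondence.inner_smul_left, hqq]

/-! ### From matrices to correspondences, and the theorem -/

lemma ElementaryShiftRelated.elementaryStrongShiftRelated {A : Matrix V V ℕ} {B : Matrix W W ℕ}
    (h : ElementaryShiftRelated A B) :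
    Correspondence.ElementaryStrongShiftRelated (graphCorrespondence A)
      (graphCorrespondence B) := by
  obtain ⟨R, S, rfl, rfl⟩ := h
  exact ⟨graphCorrespondence R, graphCorrespondence S, graphCorrespondence_mul_isomorphic R S,
    (graphCorrespondence_mul_isomorphic S R).symm⟩

lemma MatrixStrongShiftEquivalent.strongShiftEquivalent {B : Matrix W W ℕ} (m : ℕ) :
    ∀ {V : Type u} [Fintype V] {A : Matrix V V ℕ}, MatrixStrongShiftEquivalent m A B →
      Correspondence.StrongShiftEquivalent m (graphCorrespondence A) (graphCorrespondence B) := by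
  induction m with
  | zero => intro V _ A h; exact h
  | succ m ih =>
    intro V _ A h
    cases m with
    | zero => exact ElementaryShiftRelated.elementaryStrongShiftRelated h
    | succ m =>
      obtain ⟨U, _, C, hAC, hCB⟩ := h
      exact ⟨U → ℂ, inferInstance, graphCorrespondence C, hAC.elementaryStrongShiftRelated, ih hCB⟩

/-- For finite essential matrices over `ℕ`, strong shift equivalence with lag `m` of the matrices is
the same as strong shift equivalence with lag `m` of their graph correspondences; hence the two
relations of strong shift equivalence are equal. -/
theorem theoremC {V W : Type u} [Fintype V] [Fintype W]
    (A : Matrix V V ℕ) (B : Matrix W W ℕ) (hA : IsEssential A) (hB : IsEssential B) :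
    (∀ m : ℕ, 0 < m →
      (Correspondence.StrongShiftEquivalent m (graphCorrespondence A) (graphCorrespondence B) ↔
        MatrixStrongShiftEquivalent m A B)) ∧
    ((∃ m : ℕ, 0 < m ∧
      Correspondence.StrongShiftEquivalent m (graphCorrespondence A) (graphCorrespondence B)) ↔
      ∃ m : ℕ, 0 < m ∧ MatrixStrongShiftEquivalent m A B) := by
  have h : ∀ m : ℕ,
      Correspondence.StrongShiftEquivalent m (graphCorrespondence A) (graphCorrespondence B) ↔
        MatrixStrongShiftEquivalent m A B := fun m =>
    ⟨(isModel_graphCorrespondence hA.2).matrixStrongShiftEquivalent hB m,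
      MatrixStrongShiftEquivalent.strongShiftEquivalent m⟩
  exact ⟨fun m _ => h m, by simp only [h]⟩

end
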